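/- Let $(M,g)$ be a $C^r$ spacetime, $r\in\{3,\dots,\infty\}$: a connected Hausdorff $C^r$ manifold $M$ of dimension $n\ge 2$ with a $C^{r-1}$ Lorentzian metric $g$ of signature $(-,+,\dots,+)$ and a time orientation. Write $(x,y)\in J^+$ if $x=y$ or there is a piecewise $C^1$ future-directed causal curve from $x$ to $y$. Let $I^+(x)$ (resp. $I^-(x)$) be the set of points $y$ such that there is a piecewise $C^1$ future-directed timelike curve from $x$ to $y$ (resp. from $y$ to $x$). The spacetime is called - *distinguishing* if $I^+(x)=I^+(y)$ implies $x=y$, and $I^-(x)=I^-(y)$ implies $x=y$; - *feebly distinguishing* if $(x,y)\in J^+$, $I^+(x)=I^+(y)$ and $I^-(x)=I^-(y)$ together imply $x=y$; - *reflecting* if for all $x,y\in M$: $I^-(x)\subseteq I^-(y)$ if and only if $I^+(y)\subseteq I^+(x)$; - *causally continuous* if it is distinguishing and reflecting. Then $(M,g)$ is causally continuous if and only if it is feebly distinguishing and reflecting. -/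

import Mathlib

open Bundle Manifold Set
open scoped ContDiff Topology

/-- A bilinear form on a real vector space has Lorentzian signature `(-,+,…,+)`: some vector `v` has
negative square and the form is positive definite on the orthogonal complement of `v`. -/
def IsLorentzianForm {V : Type*} [AddCommGroup V] [Module ℝ V] [TopologicalSpace V]
    (b : V →L[ℝ] V →L[ℝ] ℝ) : Prop :=
  (∀ v w, b v w = b w v) ∧ ∃ v, b v v < 0 ∧ ∀ w, b v w = 0 → w ≠ 0 → 0 < b w w

/-- A Lorentzian metric of class `C^k`, together with a time orientation, on an `n`-dimensional
manifold `M` without boundary. The time orientation is given by a continuous everywhere timelike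
vector field, which is declared to be future directed. -/
structure TimeOrientedLorentzianMetric (n : ℕ) (k : ℕ∞) (M : Type*) [TopologicalSpace M]
    [ChartedSpace (EuclideanSpace ℝ (Fin n)) M] [IsManifold (𝓡 n) 1 M] where
  /-- the metric tensor -/
  g : ∀ x : M, TangentSpace (𝓡 n) x →L[ℝ] TangentSpace (𝓡 n) x →L[ℝ] ℝ
  lorentzian : ∀ x, IsLorentzianForm (g x)
  contMDiff_g : ContMDiff (𝓡 n)
    ((𝓡 n).prod 𝓘(ℝ, EuclideanSpace ℝ (Fin n) →L[ℝ] EuclideanSpace ℝ (Fin n) →L[ℝ] ℝ)) k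
    (fun x ↦ TotalSpace.mk' (EuclideanSpace ℝ (Fin n) →L[ℝ] EuclideanSpace ℝ (Fin n) →L[ℝ] ℝ)
      (E := fun x : M ↦ TangentSpace (𝓡 n) x →L[ℝ] TangentSpace (𝓡 n) x →L[ℝ] ℝ) x (g x))
  /-- the time-orienting vector field -/
  X : ∀ x : M, TangentSpace (𝓡 n) x
  continuous_X : Continuous (fun x ↦ (⟨x, X x⟩ : TangentBundle (𝓡 n) M))
  timelike_X : ∀ x, g x (X x) (X x) < 0

namespace TimeOrientedLorentzianMetric

variable {n : ℕ} {k : ℕ∞} {M : Type*} [TopologicalSpace M]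
  [ChartedSpace (EuclideanSpace ℝ (Fin n)) M] [IsManifold (𝓡 n) 1 M]

/-- A tangent vector is future-directed timelike: it is timelike and lies in the same cone as the
time-orienting field. -/
def IsFutureTimelike (S : TimeOrientedLorentzianMetric n k M) {x : M}
    (v : TangentSpace (𝓡 n) x) : Prop :=
  S.g x v v < 0 ∧ S.g x (S.X x) v < 0

/-- A tangent vector is future-directed causal: it is nonzero, timelike or lightlike, and lies in
the same closed cone as the time-orienting field. -/
def IsFutureCausal (S : TimeOrientedLorentzianMetric n k M) {x : M}
    (v : TangentSpace (𝓡 n) x) : Prop :=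
  v ≠ 0 ∧ S.g x v v ≤ 0 ∧ S.g x (S.X x) v < 0

/-- The velocity at time `t` of a curve defined on `[0, 1]` (one-sided at the endpoints). -/
noncomputable def velocity (γ : ℝ → M) (t : ℝ) : TangentSpace (𝓡 n) (γ t) :=
  mfderivWithin 𝓘(ℝ, ℝ) (𝓡 n) γ (Icc 0 1) t (1 : ℝ)

/-- There is a `C^1` future-directed timelike curve `γ : [0, 1] → M` from `x` to `y`. -/
def TimelikeArc (S : TimeOrientedLorentzianMetric n k M) (x y : M) : Prop :=
  ∃ γ : ℝ → M, ContMDiffOn 𝓘(ℝ, ℝ) (𝓡 n) 1 γ (Icc 0 1) ∧ γ 0 = x ∧ γ 1 = y ∧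
    ∀ t ∈ Icc (0 : ℝ) 1, S.IsFutureTimelike (velocity (n := n) γ t)

/-- There is a `C^1` future-directed causal curve `γ : [0, 1] → M` from `x` to `y`. -/
def CausalArc (S : TimeOrientedLorentzianMetric n k M) (x y : M) : Prop :=
  ∃ γ : ℝ → M, ContMDiffOn 𝓘(ℝ, ℝ) (𝓡 n) 1 γ (Icc 0 1) ∧ γ 0 = x ∧ γ 1 = y ∧
    ∀ t ∈ Icc (0 : ℝ) 1, S.IsFutureCausal (velocity (n := n) γ t)

/-- The chronological relation `x ≪ y`: there is a piecewise `C^1` future-directed timelike curve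
from `x` to `y`, i.e. a concatenation of finitely many (at least one) `C^1` timelike arcs. -/
def Chron (S : TimeOrientedLorentzianMetric n k M) (x y : M) : Prop :=
  Relation.TransGen S.TimelikeArc x y

/-- The causal relation `x ≤ y`: either `x = y` or there is a piecewise `C^1` future-directed causal
curve from `x` to `y`, i.e. a concatenation of finitely many `C^1` causal arcs. -/
def Causal (S : TimeOrientedLorentzianMetric n k M) (x y : M) : Prop :=
  Relation.ReflTransGen S.CausalArc x y

/-- The chronological future `I⁺(x)`. -/
def chronFuture (S : TimeOrientedLorentzianMetric n k M) (x : M) : Set M := {y | S.Chron x y}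

/-- The chronological past `I⁻(x)`. -/
def chronPast (S : TimeOrientedLorentzianMetric n k M) (x : M) : Set M := {y | S.Chron y x}

/-- Future distinction: `x ↦ I⁺(x)` is injective. -/
def FutureDistinguishing (S : TimeOrientedLorentzianMetric n k M) : Prop :=
  ∀ x y : M, S.chronFuture x = S.chronFuture y → x = y

/-- Past distinction: `x ↦ I⁻(x)` is injective. -/
def PastDistinguishing (S : TimeOrientedLorentzianMetric n k M) : Prop :=
  ∀ x y : M, S.chronPast x = S.chronPast y → x = y

/-- Distinction: both future and past distinction. -/
def Distinguishing (S : TimeOrientedLorentzianMetric n k M) : Prop :=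
  S.FutureDistinguishing ∧ S.PastDistinguishing

/-- Feeble distinction: no two distinct causally related events have the same chronological future
and the same chronological past. -/
def FeeblyDistinguishing (S : TimeOrientedLorentzianMetric n k M) : Prop :=
  ∀ x y : M, S.Causal x y → S.chronFuture x = S.chronFuture y →
    S.chronPast x = S.chronPast y → x = y

/-- Future reflectivity: `I⁻(x) ⊆ I⁻(y)` implies `I⁺(y) ⊆ I⁺(x)`. -/
def FutureReflecting (S : TimeOrientedLorentzianMetric n k M) : Prop :=
  ∀ x y : M, S.chronPast x ⊆ S.chronPast y → S.chronFuture y ⊆ S.chronFuture x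

/-- Past reflectivity: `I⁺(y) ⊆ I⁺(x)` implies `I⁻(x) ⊆ I⁻(y)`. -/
def PastReflecting (S : TimeOrientedLorentzianMetric n k M) : Prop :=
  ∀ x y : M, S.chronFuture y ⊆ S.chronFuture x → S.chronPast x ⊆ S.chronPast y

/-- Reflectivity: both future and past reflectivity. -/
def Reflecting (S : TimeOrientedLorentzianMetric n k M) : Prop :=
  S.FutureReflecting ∧ S.PastReflecting

/-- Causal continuity: distinction and reflectivity. -/
def CausallyContinuous (S : TimeOrientedLorentzianMetric n k M) : Prop :=
  S.Distinguishing ∧ S.Reflecting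

end TimeOrientedLorentzianMetric

/-! Distinction trivially implies feeble distinction, so the content is that a feebly
distinguishing, reflecting spacetime is distinguishing. Reflectivity turns equal futures into equal
pasts, so it suffices to treat x ≠ y with I⁻(x) = I⁻(y).

Take points z ≪ y tending to y. Each satisfies z ≪ x, and a timelike curve from z to x must leave a
small coordinate ball about y that misses x. A limit of these curves is a curve σ from y with
I⁻(σ(t)) ⊆ I⁻(x) = I⁻(y), and with I⁺(σ(t)) ⊆ I⁺(p) for every p ≪ y
(`LorentzChart.exists_limit_curve`). Past reflectivity and openness of ≪ give I⁻(y) ⊆ I⁻(σ(t)), so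
all σ(t) have the same past as y, and by reflectivity the same future. If y and σ(δ) are causally
related, this contradicts feeble distinction.

The difficulty is that σ is a priori only Lipschitz, whereas causal curves here are piecewise C¹.
Regularity comes from achronality. Two points of σ are never chronologically related, since their
pasts agree and there is no closed timelike curve (`FeeblyDistinguishing.not_chron_self`). Hence
chords of σ cannot be clearly timelike, while as limits of chords of timelike curves they cannot be
clearly spacelike either (`ConeField.Precedes.metric_le`). So g(Δσ, Δσ) = O(|Δt|³). For vectors of
zero time component the metric controls the norm. Applied to weighted second differences, this makes
adjacent difference quotients agree up to O(√h), and σ is therefore a C¹ null curve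
(`ConeField.exists_hasDerivWithinAt_of_abs_metric_le`). -/

namespace TimeOrientedLorentzianMetric

/-! ### The metric, the time orientation and velocities in a chart -/

variable {n : ℕ} {k : ℕ∞} {M : Type*} [TopologicalSpace M]
  [ChartedSpace (EuclideanSpace ℝ (Fin n)) M] [IsManifold (𝓡 n) 1 M]

/-- The components of a tangent vector at `m` in the preferred chart at `y`. -/
noncomputable def coord (y m : M) :
    TangentSpace (𝓡 n) m →L[ℝ] EuclideanSpace ℝ (Fin n) :=
  (trivializationAt (EuclideanSpace ℝ (Fin n)) (TangentSpace (𝓡 n)) y).continuousLinearMapAt ℝ m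

/-- The metric in the preferred chart at `y`. -/
noncomputable def coordMetric (S : TimeOrientedLorentzianMetric n k M) (y : M)
    (u : EuclideanSpace ℝ (Fin n)) :
    EuclideanSpace ℝ (Fin n) →L[ℝ] EuclideanSpace ℝ (Fin n) →L[ℝ] ℝ :=
  ContinuousLinearMap.inCoordinates (EuclideanSpace ℝ (Fin n)) (TangentSpace (𝓡 n) (M := M))
    (EuclideanSpace ℝ (Fin n) →L[ℝ] ℝ) (fun x : M ↦ TangentSpace (𝓡 n) x →L[ℝ] ℝ)
    y ((extChartAt (𝓡 n) y).symm u) y ((extChartAt (𝓡 n) y).symm u)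
    (S.g ((extChartAt (𝓡 n) y).symm u))

theorem coord_bijective {y m : M} (hm : m ∈ (extChartAt (𝓡 n) y).source) :
    Function.Bijective (coord (n := n) y m) := by
  have hb : m ∈ (trivializationAt (EuclideanSpace ℝ (Fin n))
      (TangentSpace (𝓡 n) (M := M)) y).baseSet := by simpa using hm
  rw [coord, ← Trivialization.coe_continuousLinearEquivAt_eq _ hb]
  exact ContinuousLinearEquiv.bijective _

theorem coordMetric_apply (S : TimeOrientedLorentzianMetric n k M) {y m : M}
    (hm : m ∈ (extChartAt (𝓡 n) y).source) (v w : TangentSpace (𝓡 n) m) :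
    S.coordMetric y (extChartAt (𝓡 n) y m) (coord y m v) (coord y m w) = S.g m v w := by
  have hb : m ∈ (trivializationAt (EuclideanSpace ℝ (Fin n))
      (TangentSpace (𝓡 n) (M := M)) y).baseSet := by simpa using hm
  -- The base point `φ.symm (φ m)` equals `m` only propositionally and tangent spaces depend on it,
  -- so it is generalized to a variable before the equality is eliminated.
  have key : ∀ (m' : M) (_ : m' = m), ContinuousLinearMap.inCoordinates
      (EuclideanSpace ℝ (Fin n)) (TangentSpace (𝓡 n) (M := M))
      (EuclideanSpace ℝ (Fin n) →L[ℝ] ℝ) (fun x : M ↦ TangentSpace (𝓡 n) x →L[ℝ] ℝ)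
      y m' y m' (S.g m') (coord y m v) (coord y m w) = S.g m v w := by
    rintro m' rfl
    have A : ∀ v : TangentSpace (𝓡 n) m', (trivializationAt (EuclideanSpace ℝ (Fin n))
        (TangentSpace (𝓡 n) (M := M)) y).symm m' (coord y m' v) = v := fun v ↦ by
      rw [coord, ← Trivialization.coe_continuousLinearEquivAt_eq _ hb]
      exact ((trivializationAt (EuclideanSpace ℝ (Fin n))
        (TangentSpace (𝓡 n) (M := M)) y).continuousLinearEquivAt ℝ m' hb).symm_apply_apply v
    refine (inCoordinates_apply_eq₂ (𝕜 := ℝ) (F₃ := ℝ) (E₃ := Bundle.Trivial M ℝ) hb hb (Set.mem_univ _)).trans ?_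
    rw [A, A]
    simp
  exact key _ ((extChartAt (𝓡 n) y).left_inv hm)

theorem contDiffAt_coordMetric (S : TimeOrientedLorentzianMetric n k M) (y : M) :
    ContDiffAt ℝ k (S.coordMetric y) (extChartAt (𝓡 n) y y) := by
  have h := S.contMDiff_g y
  rw [contMDiffAt_hom_bundle] at h
  have h2 := h.2
  have h3 := (contMDiffAt_iff.1 h2).2
  simpa using! h3

theorem continuousAt_coord_X (S : TimeOrientedLorentzianMetric n k M) (y : M) :
    ContinuousAt (fun m ↦ coord y m (S.X m)) y := by
  have h := ((FiberBundle.continuousAt_totalSpace (EuclideanSpace ℝ (Fin n)) _).1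
    (S.continuous_X.continuousAt (x := y))).2
  refine h.congr ?_
  filter_upwards [(chartAt (EuclideanSpace ℝ (Fin n)) y).open_source.mem_nhds
    (mem_chart_source _ y)] with m hm
  have hb : m ∈ (trivializationAt (EuclideanSpace ℝ (Fin n))
      (TangentSpace (𝓡 n) (M := M)) y).baseSet := by simpa using hm
  rw [coord, ← Trivialization.coe_continuousLinearEquivAt_eq _ hb]
  rfl

theorem hasDerivWithinAt_extChartAt_comp {y : M} {γ : ℝ → M}
    (hγ : ContMDiffOn 𝓘(ℝ, ℝ) (𝓡 n) 1 γ (Icc 0 1)) {t : ℝ} (ht : t ∈ Icc (0 : ℝ) 1)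
    (hm : γ t ∈ (extChartAt (𝓡 n) y).source) :
    HasDerivWithinAt (fun s ↦ extChartAt (𝓡 n) y (γ s)) (coord y (γ t) (velocity γ t))
      (Icc 0 1) t := by
  have hs : γ t ∈ (chartAt (EuclideanSpace ℝ (Fin n)) y).source := by simpa using hm
  have h1 := ((hγ t ht).mdifferentiableWithinAt one_ne_zero).hasMFDerivWithinAt
  have h2 := (mdifferentiableAt_extChartAt (I := 𝓡 n) hs).hasMFDerivAt
  have h4 := TangentBundle.continuousLinearMapAt_trivializationAt (I := 𝓡 n) (𝕜 := ℝ) hs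
  rw [coord, h4]
  have h3 := (hasMFDerivWithinAt_iff_hasFDerivWithinAt).1 (h2.comp_hasMFDerivWithinAt t h1)
  refine hasDerivWithinAt_iff_hasFDerivWithinAt.2 (HasFDerivWithinAt.congr_fderiv h3 ?_)
  ext1
  exact (one_smul ℝ (_ : EuclideanSpace ℝ (Fin n))).symm

end TimeOrientedLorentzianMetric

/-! ### Lorentzian forms: coercivity modulo one timelike covector -/

section LinearAlgebra

/-- The signature is stated with one particular timelike `v`; it must hold for every timelike `x`.
If `b w w ≤ 0`, the form is nonpositive on the span of `x` and `w`, and that span contains the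
vector `b v w • x - b v x • w`, orthogonal to `v`. It must vanish, which is impossible. -/
theorem IsLorentzianForm.pos_of_orthogonal {V : Type*} [AddCommGroup V] [Module ℝ V]
    [TopologicalSpace V] {b : V →L[ℝ] V →L[ℝ] ℝ} (hb : IsLorentzianForm b) {x : V}
    (hx : b x x < 0) {w : V} (hw : b x w = 0) (hw0 : w ≠ 0) : 0 < b w w := by
  obtain ⟨hsymm, v, -, hpos⟩ := hb
  by_contra! hneg
  have hvx : b v x ≠ 0 := fun h ↦ by
    have hx0 : x ≠ 0 := by rintro rfl; simp at hx
    linarith [hpos x h hx0]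
  have hz : b v w • x - b v x • w = 0 := by
    by_contra h
    have h1 := hpos _ (by simp; ring) h
    have h2 : b (b v w • x - b v x • w) (b v w • x - b v x • w)
        = (b v w) ^ 2 * b x x + (b v x) ^ 2 * b w w := by
      simp [hw, hsymm w x]; ring
    nlinarith [sq_nonneg (b v w), sq_nonneg (b v x)]
  have h3 : b v w * b x x = 0 := by
    have := congrArg (b x) hz
    simpa [hw] using this
  have h4 : b v w = 0 := (mul_eq_zero.1 h3).resolve_right hx.ne
  rw [h4, zero_smul, zero_sub, neg_eq_zero, smul_eq_zero] at hz
  exact hz.elim hvx hw0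

variable {E : Type*} [NormedAddCommGroup E] [NormedSpace ℝ E]

theorem exists_pos_mul_sq_norm_le [FiniteDimensional ℝ E] {q : E → ℝ} (hq : Continuous q)
    (hsmul : ∀ (a : ℝ) v, q (a • v) = a ^ 2 * q v) (hpos : ∀ v, v ≠ 0 → 0 < q v) :
    ∃ c > 0, ∀ v, c * ‖v‖ ^ 2 ≤ q v := by
  have h0 : q 0 = 0 := by simpa using hsmul 0 0
  rcases (Metric.sphere (0 : E) 1).eq_empty_or_nonempty with h | h
  · refine ⟨1, one_pos, fun v ↦ ?_⟩
    by_cases hv : v = 0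
    · simp [hv, h0]
    · have : ‖v‖⁻¹ • v ∈ Metric.sphere (0 : E) 1 := by simp [norm_smul, hv]
      simp [h] at this
  · obtain ⟨w, hw, hmin⟩ := (isCompact_sphere (0 : E) 1).exists_isMinOn h hq.continuousOn
    have hw0 : w ≠ 0 := by rintro rfl; simp at hw
    refine ⟨q w, hpos w hw0, fun v ↦ ?_⟩
    by_cases hv : v = 0
    · simp [hv, h0]
    · have hn : 0 < ‖v‖ := norm_pos_iff.2 hv
      have h1 : q w ≤ q (‖v‖⁻¹ • v) := hmin (by simp [norm_smul, hv])
      rw [hsmul, inv_pow, ← div_eq_inv_mul, le_div_iff₀ (by positivity)] at h1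
      exact h1

/-- Flipping the sign of the form along `x` makes it positive definite, and compactness of the
sphere does the rest. The factor 2 matters: a single `(b x v) ^ 2 / (-b x x)` only cancels the
negative direction, and the second makes it positive. -/
theorem IsLorentzianForm.exists_coercive [FiniteDimensional ℝ E] {b : E →L[ℝ] E →L[ℝ] ℝ}
    (hb : IsLorentzianForm b) {x : E} (hx : b x x < 0) :
    ∃ c > 0, ∃ C > 0, ∀ v, c * ‖v‖ ^ 2 ≤ b v v + C * (b x v) ^ 2 := by
  have hN : 0 < (- b x x)⁻¹ := inv_pos.2 (by linarith)
  obtain ⟨c, hc, h⟩ := exists_pos_mul_sq_norm_le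
    (q := fun v ↦ b v v + 2 * (- b x x)⁻¹ * (b x v) ^ 2) (by fun_prop)
    (fun a v ↦ by simp; ring) (fun v hv ↦ by
      by_cases hxv : b x v = 0
      · simpa [hxv] using hb.pos_of_orthogonal hx hxv hv
      · set w := v - (b x v / b x x) • x with hw
        have h1 : b x w = 0 := by simp [hw, div_mul_cancel₀ _ hx.ne]
        have h2 : 0 ≤ b w w := by
          by_cases hw0 : w = 0
          · simp [hw0]
          · exact (hb.pos_of_orthogonal hx h1 hw0).le
        have h3 : b w w = b v v + (- b x x)⁻¹ * (b x v) ^ 2 := by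
          simp [hw, hb.1 v x]
          field_simp [hx.ne]
          ring
        have : 0 < (- b x x)⁻¹ * (b x v) ^ 2 := by positivity
        linarith)
  exact ⟨c, hc, _, by positivity, h⟩

end LinearAlgebra

/-- A field of Lorentzian cones on a ball of a normed space, together with a linear functional
which is a uniform time function for it. -/
structure ConeField (E : Type*) [NormedAddCommGroup E] [NormedSpace ℝ E] where
  /-- the quadratic form whose nonpositive vectors are the causal ones -/
  metric : E → E →L[ℝ] E →L[ℝ] ℝ
  /-- the time function -/
  time : E →L[ℝ] ℝ
  /-- the centre of the domain -/
  center : E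
  /-- the radius of the domain -/
  radius : ℝ
  /-- the coercivity constant -/
  c : ℝ
  /-- the weight of the time function in the coercivity estimate -/
  C : ℝ
  /-- the Lipschitz constant of the metric -/
  L : ℝ
  radius_pos : 0 < radius
  c_pos : 0 < c
  C_pos : 0 < C
  L_nonneg : 0 ≤ L
  symm : ∀ u ∈ Metric.ball center radius, ∀ v w, metric u v w = metric u w v
  coercive : ∀ u ∈ Metric.ball center radius, ∀ v,
    c * ‖v‖ ^ 2 ≤ metric u v v + C * (time v) ^ 2
  lipschitz : ∀ u ∈ Metric.ball center radius, ∀ w ∈ Metric.ball center radius,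
    ‖metric u - metric w‖ ≤ L * ‖u - w‖

/-! ### Displacements along timelike curves of a cone field -/

namespace ConeField

variable {E : Type*} [NormedAddCommGroup E] [NormedSpace ℝ E] (K : ConeField E)

/-- The domain of a cone field. -/
def ball : Set E := Metric.ball K.center K.radius

/-- Future-directed timelike vectors of a cone field. -/
def Timelike (u v : E) : Prop := K.metric u v v < 0 ∧ 0 < K.time v

/-- Causal vectors have slope at least `K.slope` with respect to the time function. -/
noncomputable def slope : ℝ := √(K.c / K.C)

theorem slope_pos : 0 < K.slope := Real.sqrt_pos.2 (div_pos K.c_pos K.C_pos)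

variable {K}

theorem slope_mul_norm_le {u v : E} (hu : u ∈ K.ball) (hv : K.metric u v v ≤ 0) :
    K.slope * ‖v‖ ≤ |K.time v| := by
  have h := K.coercive u hu v
  have h1 : K.slope ^ 2 = K.c / K.C := Real.sq_sqrt (div_pos K.c_pos K.C_pos).le
  refine abs_le_of_sq_le_sq' ?_ (abs_nonneg _) |>.2
  rw [mul_pow, h1, sq_abs, div_mul_eq_mul_div, div_le_iff₀ K.C_pos]
  linarith

theorem Timelike.slope_mul_norm_le {u v : E} (hu : u ∈ K.ball) (hv : K.Timelike u v) :
    K.slope * ‖v‖ ≤ K.time v := by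
  simpa [abs_of_pos hv.2] using ConeField.slope_mul_norm_le hu hv.1.le

theorem abs_metric_sub_le {u w : E} (hu : u ∈ K.ball) (hw : w ∈ K.ball) (v : E) :
    |K.metric u v v - K.metric w v v| ≤ K.L * ‖u - w‖ * ‖v‖ ^ 2 := by
  have h := (K.metric u - K.metric w).le_opNorm₂ v v
  have h2 := K.lipschitz u hu w hw
  simp only [_root_.sub_apply, Real.norm_eq_abs] at h
  refine h.trans ?_
  rw [mul_assoc, ← sq]
  gcongr

/-- There is a differentiable future-directed timelike arc from `a` to `b`. -/
def Step (K : ConeField E) (a b : E) : Prop :=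
  ∃ (f f' : ℝ → E) (s₀ s₁ : ℝ), s₀ < s₁ ∧ f s₀ = a ∧ f s₁ = b ∧ ∀ s ∈ Icc s₀ s₁,
    HasDerivWithinAt f (f' s) (Icc s₀ s₁) s ∧ f s ∈ K.ball ∧ K.Timelike (f s) (f' s)

/-- There is a piecewise differentiable future-directed timelike curve from `a` to `b`. -/
def Precedes (K : ConeField E) : E → E → Prop := Relation.TransGen K.Step

theorem apply_le_apply_of_arc {f f' : ℝ → E} {s₀ s₁ : ℝ} (hs : s₀ ≤ s₁)
    (hf : ∀ s ∈ Icc s₀ s₁, HasDerivWithinAt f (f' s) (Icc s₀ s₁) s) (Φ : E →L[ℝ] ℝ)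
    (hΦ : ∀ s ∈ Icc s₀ s₁, 0 ≤ Φ (f' s)) : Φ (f s₀) ≤ Φ (f s₁) := by
  have h1 : ∀ s ∈ Icc s₀ s₁, HasDerivWithinAt (fun s ↦ Φ (f s)) (Φ (f' s)) (Icc s₀ s₁) s :=
    fun s h ↦ Φ.hasFDerivAt.comp_hasDerivWithinAt s (hf s h)
  refine monotoneOn_of_hasDerivWithinAt_nonneg (convex_Icc s₀ s₁)
    (fun s h ↦ (h1 s h).continuousWithinAt)
    (fun s h ↦ (h1 s (interior_subset h)).mono interior_subset)
    (fun s h ↦ hΦ s (interior_subset h)) (left_mem_Icc.2 hs) (right_mem_Icc.2 hs) hs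

/-- The bound on velocities integrates: for a functional `g` norming the displacement, `K.time -
K.slope • g` is nonnegative on timelike velocities, hence nondecreasing along the arc. -/
theorem slope_mul_norm_le_of_arc {f f' : ℝ → E} {s₀ s₁ : ℝ} (hs : s₀ ≤ s₁)
    (hf : ∀ s ∈ Icc s₀ s₁, HasDerivWithinAt f (f' s) (Icc s₀ s₁) s ∧ f s ∈ K.ball ∧
      K.Timelike (f s) (f' s)) :
    K.slope * ‖f s₁ - f s₀‖ ≤ K.time (f s₁ - f s₀) := by
  obtain ⟨g, hg, hg'⟩ := exists_dual_vector'' ℝ (f s₁ - f s₀)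
  have h := apply_le_apply_of_arc hs (fun s h ↦ (hf s h).1) (K.time - K.slope • g) (fun s h ↦ by
    have h1 := Timelike.slope_mul_norm_le (hf s h).2.1 (hf s h).2.2
    have h2 : g (f' s) ≤ ‖f' s‖ := (Real.le_norm_self _).trans
      ((g.le_opNorm _).trans (mul_le_of_le_one_left (norm_nonneg _) hg))
    have h3 := mul_le_mul_of_nonneg_left h2 K.slope_pos.le
    simp; linarith)
  simp only [RCLike.ofReal_real_eq_id, id_eq] at hg'
  rw [← hg']
  simp only [_root_.sub_apply, _root_.smul_apply, smul_eq_mul,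
    map_sub] at h ⊢
  linarith

theorem Step.slope_mul_norm_le {a b : E} (h : K.Step a b) :
    K.slope * ‖b - a‖ ≤ K.time (b - a) := by
  obtain ⟨f, f', s₀, s₁, hs, rfl, rfl, hf⟩ := h
  exact slope_mul_norm_le_of_arc hs.le hf

theorem slope_mul_norm_le_trans {a b d : E} (h : K.slope * ‖b - a‖ ≤ K.time (b - a))
    (h' : K.slope * ‖d - b‖ ≤ K.time (d - b)) : K.slope * ‖d - a‖ ≤ K.time (d - a) := by
  have h1 : ‖d - a‖ ≤ ‖d - b‖ + ‖b - a‖ := norm_sub_le_norm_sub_add_norm_sub d b a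
  have h2 := mul_le_mul_of_nonneg_left h1 K.slope_pos.le
  simp only [map_sub] at *
  linarith

theorem Precedes.slope_mul_norm_le {a b : E} (h : K.Precedes a b) :
    K.slope * ‖b - a‖ ≤ K.time (b - a) := by
  induction h with
  | single h => exact h.slope_mul_norm_le
  | tail _ h ih => exact slope_mul_norm_le_trans ih h.slope_mul_norm_le

theorem time_le_of_slope_mul_norm_le {a b : E} (h : K.slope * ‖b - a‖ ≤ K.time (b - a)) :
    K.time a ≤ K.time b := by
  have := mul_nonneg K.slope_pos.le (norm_nonneg (b - a))
  rw [map_sub] at h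
  linarith

theorem Precedes.mem_ball {a b : E} (h : K.Precedes a b) : a ∈ K.ball := by
  induction h with
  | single h =>
    obtain ⟨f, f', s₀, s₁, hs, rfl, rfl, hf⟩ := h
    exact (hf s₀ (left_mem_Icc.2 hs.le)).2.1
  | tail _ _ ih => exact ih

/-- The slope inequality and monotonicity of time confine the curve to a cone over `a` below the
level `τ`, so the sign of `Φ` is needed only there. This confinement makes the error in the frozen
metric proportional to the elapsed time. -/
theorem Precedes.apply_le_apply {a b : E} (h : K.Precedes a b) (Φ : E →L[ℝ] ℝ) {τ : ℝ}
    (hτ : K.time b ≤ τ)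
    (hΦ : ∀ u ∈ K.ball, K.slope * ‖u - a‖ ≤ K.time (u - a) → K.time u ≤ τ →
      ∀ v, K.Timelike u v → 0 ≤ Φ v) : Φ a ≤ Φ b := by
  have step : ∀ p q, K.slope * ‖p - a‖ ≤ K.time (p - a) → K.Step p q → K.time q ≤ τ →
      Φ p ≤ Φ q := by
    rintro p q hp ⟨f, f', s₀, s₁, hs, rfl, rfl, hf⟩ hq
    refine apply_le_apply_of_arc hs.le (fun s h ↦ (hf s h).1) Φ fun s h ↦ ?_
    refine hΦ (f s) (hf s h).2.1 (slope_mul_norm_le_trans hp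
      (slope_mul_norm_le_of_arc (f' := f') h.1 fun t ht ↦ ?_))
      ((time_le_of_slope_mul_norm_le (slope_mul_norm_le_of_arc (f' := f') h.2 fun t ht ↦ ?_)).trans hq) _
      (hf s h).2.2
    · obtain ⟨h1, h2⟩ := hf t ⟨ht.1, ht.2.trans h.2⟩
      exact ⟨h1.mono (Icc_subset_Icc_right h.2), h2⟩
    · obtain ⟨h1, h2⟩ := hf t ⟨h.1.trans ht.1, ht.2⟩
      exact ⟨h1.mono (Icc_subset_Icc_left h.1), h2⟩
  induction h with
  | single h => exact step _ _ (by simp) h hτ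
  | tail h' h ih =>
    have := time_le_of_slope_mul_norm_le h.slope_mul_norm_le
    exact (ih (this.trans hτ)).trans (step _ _ (Precedes.slope_mul_norm_le h') h hτ)

/-- The displacement between chronologically related points is causal up to third order. -/
theorem Precedes.metric_le {a b : E} (h : K.Precedes a b) :
    K.metric a (b - a) (b - a) ≤ K.L / K.slope ^ 3 * (K.time (b - a)) ^ 3 := by
  have ha := h.mem_ball
  have hκ := K.slope_pos
  have hn := h.slope_mul_norm_le
  set Δ := b - a with hΔ
  have hT : 0 ≤ K.time Δ := (mul_nonneg hκ.le (norm_nonneg _)).trans hn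
  -- The widening of the frozen cone: points of the curve lie within `K.time Δ / K.slope` of `a` and
  -- velocities satisfy `‖v‖ ≤ K.time v / K.slope`, so freezing the metric at `a` costs at most `η *
  -- (K.time v) ^ 2`.
  set η := K.L / K.slope ^ 3 * K.time Δ with hη
  have hη0 : 0 ≤ η := mul_nonneg (div_nonneg K.L_nonneg (by positivity)) hT
  -- By coercivity this form is positive, so Cauchy–Schwarz applies to it. Timelike velocities
  -- satisfy `B v v ≤ (C + η) * (K.time v) ^ 2`.
  set B : E → E → ℝ := fun v w ↦ K.metric a v w + K.C * (K.time v * K.time w) with hB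
  have hBpos : ∀ v, 0 ≤ B v v := fun v ↦ by
    have := K.coercive a ha v
    have h2 := mul_nonneg K.c_pos.le (sq_nonneg ‖v‖)
    simp only [hB]; nlinarith
  have cs : ∀ v w, (B v w) ^ 2 ≤ B v v * B w w := fun v w ↦ by
    have hq : ∀ s : ℝ, 0 ≤ B w w * (s * s) + 2 * B v w * s + B v v := fun s ↦ by
      have h1 := hBpos (v + s • w)
      have h2 : B (v + s • w) (v + s • w) = B w w * (s * s) + 2 * B v w * s + B v v := by
        simp only [hB, map_add, map_smul, _root_.add_apply,
          _root_.smul_apply, smul_eq_mul, K.symm a ha w v]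
        ring
      linarith
    have := discrim_le_zero hq
    rw [discrim] at this
    nlinarith
  have hC : 0 ≤ K.C + η := by linarith [K.C_pos]
  set N := B Δ Δ with hN
  -- The functional is `v ↦ √((C + η) * N) * K.time v - B v Δ`, nonnegative on the velocities by
  -- Cauchy–Schwarz. Its increment from `a` to `b` gives `N ≤ √((C + η) * N) * K.time Δ`, hence `N ≤
  -- (C + η) * (K.time Δ) ^ 2`.
  have key := h.apply_le_apply (√((K.C + η) * N) • K.time
      - (K.metric a).flip Δ - (K.C * K.time Δ) • K.time) le_rfl (fun u hu hua hub v hv ↦ by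
    have h1 := hv.slope_mul_norm_le hu
    have h2 := abs_metric_sub_le ha hu v
    have h3 : K.slope * ‖a - u‖ ≤ K.time Δ := by
      rw [norm_sub_rev]
      refine hua.trans ?_
      simp only [hΔ, map_sub]; linarith
    have h4 : B v v ≤ (K.C + η) * (K.time v) ^ 2 := by
      have h5 : K.L * ‖a - u‖ * ‖v‖ ^ 2 ≤ η * (K.time v) ^ 2 := by
        have e : K.L * ‖a - u‖ * ‖v‖ ^ 2
            = K.L / K.slope ^ 3 * ((K.slope * ‖a - u‖) * (K.slope * ‖v‖) ^ 2) := by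
          field_simp
        have := K.L_nonneg
        rw [e, hη, mul_assoc (K.L / K.slope ^ 3)]
        gcongr
      have h6 := (abs_le.1 h2).2
      simp only [hB]
      linarith [hv.1]
    have h7 : B v Δ ≤ √((K.C + η) * N) * K.time v := by
      have h8 : (B v Δ) ^ 2 ≤ (√((K.C + η) * N) * K.time v) ^ 2 := by
        rw [mul_pow, Real.sq_sqrt (mul_nonneg hC (hBpos Δ))]
        have := mul_le_mul_of_nonneg_right h4 (hBpos Δ)
        linarith [cs v Δ]
      exact (abs_le_of_sq_le_sq' h8 (mul_nonneg (Real.sqrt_nonneg _) hv.2.le)).2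
    simp only [_root_.sub_apply, _root_.smul_apply, smul_eq_mul,
      ContinuousLinearMap.flip_apply]
    simp only [hB] at h7
    linarith)
  have h1 : N ≤ √((K.C + η) * N) * K.time Δ := by
    have e : N = K.metric a b Δ - K.metric a a Δ
        + K.C * ((K.time b - K.time a) * K.time Δ) := by
      rw [hN]
      simp only [hB]
      rw [show K.metric a Δ Δ = K.metric a b Δ - K.metric a a Δ by
        conv_lhs => enter [1]; rw [hΔ, map_sub]
        simp, show K.time Δ = K.time b - K.time a by rw [hΔ, map_sub]]
    have e2 : K.time Δ = K.time b - K.time a := by rw [hΔ, map_sub]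
    simp only [_root_.sub_apply, _root_.smul_apply, smul_eq_mul,
      ContinuousLinearMap.flip_apply] at key
    have e3 : √((K.C + η) * N) * K.time Δ
        = √((K.C + η) * N) * K.time b - √((K.C + η) * N) * K.time a := by rw [e2]; ring
    rw [e3]
    linarith
  have hN0 : 0 ≤ N := hBpos Δ
  have h2 : N ≤ (K.C + η) * (K.time Δ) ^ 2 := by
    have h3 : N ^ 2 ≤ (K.C + η) * N * (K.time Δ) ^ 2 := by
      rw [← Real.sq_sqrt (mul_nonneg hC hN0), ← mul_pow]
      gcongr
    rcases hN0.eq_or_lt with h0 | h0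
    · rw [← h0]; positivity
    · exact le_of_mul_le_mul_left (by linarith) h0
  have h3 : K.metric a Δ Δ ≤ η * (K.time Δ) ^ 2 := by
    simp only [hN, hB] at h2
    linarith
  refine h3.trans_eq ?_
  rw [hη]; ring

end ConeField

/-! ### Differentiability from comparison of difference quotients -/

section Slopes

/-- Rounding 1/√2 up to 3/4 closes the halving induction with constant 4, because 4 · 3/4 + 1 = 4.
-/
theorem sqrt_half_le (h : ℝ) : √(h / 2) ≤ 3 / 4 * √h := by
  rw [Real.sqrt_le_left (by positivity), mul_pow]
  rcases le_or_gt 0 h with h0 | h0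
  · rw [Real.sq_sqrt h0]; linarith
  · rw [Real.sqrt_eq_zero_of_nonpos h0.le]; linarith

/-- If `e` changes by at most `A √h` when the length `h` shrinks by a factor of at most two, it
changes by at most `4 A √h` when it shrinks arbitrarily. -/
theorem norm_sub_le_of_doubling {E : Type*} [SeminormedAddCommGroup E] {e : ℝ → E} {A H : ℝ} (hA : 0 ≤ A)
    (he : ∀ h₁ h, 0 < h₁ → h₁ ≤ h → h ≤ 2 * h₁ → h ≤ H → ‖e h₁ - e h‖ ≤ A * √h)
    {h₁ h : ℝ} (h₁0 : 0 < h₁) (hle : h₁ ≤ h) (hH : h ≤ H) : ‖e h₁ - e h‖ ≤ 4 * A * √h := by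
  have main : ∀ (k : ℕ) (h : ℝ), h₁ ≤ h → h ≤ 2 ^ k * h₁ → h ≤ H →
      ‖e h₁ - e h‖ ≤ 4 * A * √h := by
    intro k
    induction k with
    | zero =>
      intro h h1 h2 _
      obtain rfl : h₁ = h := le_antisymm h1 (by simpa using h2)
      simpa using mul_nonneg (mul_nonneg (by norm_num) hA) (Real.sqrt_nonneg _)
    | succ k ih =>
      intro h h1 h2 h3
      by_cases h4 : h ≤ 2 * h₁
      · refine (he h₁ h h₁0 h1 h4 h3).trans ?_
        have := mul_nonneg hA (Real.sqrt_nonneg h)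
        linarith
      · have h5 := ih (h / 2) (by linarith) (by rw [pow_succ] at h2; linarith) (by linarith)
        have h6 := he (h / 2) h (by linarith) (by linarith) (by linarith) h3
        have h7 := norm_sub_le_norm_sub_add_norm_sub (e h₁) (e (h / 2)) (e h)
        have h8 := mul_le_mul_of_nonneg_left (sqrt_half_le h) (mul_nonneg (by norm_num : (0:ℝ) ≤ 4) hA)
        linarith
  obtain ⟨k, hk⟩ := pow_unbounded_of_one_lt (h / h₁) (one_lt_two (α := ℝ))
  exact main k h hle ((div_le_iff₀ h₁0).1 hk.le) hH

variable {E : Type*} [NormedAddCommGroup E] [NormedSpace ℝ E]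

/-- Here and for the right endpoint, the difference of slopes is a multiple of one and the same
weighted second difference, so a single estimate serves both. -/
theorem slope_sub_slope_left (f : ℝ → E) {s r t : ℝ} (h₁ : s < r) (h₂ : r < t) :
    slope f s r - slope f s t
      = ((r - s) * (t - s))⁻¹ • ((t - r) • (f r - f s) - (r - s) • (f t - f r)) := by
  have n1 : r - s ≠ 0 := sub_ne_zero.2 h₁.ne'
  have n2 : t - s ≠ 0 := sub_ne_zero.2 (h₁.trans h₂).ne'
  simp only [slope_def_module, mul_inv]
  match_scalars <;> field_simp <;> ring

theorem slope_sub_slope_right (f : ℝ → E) {s r t : ℝ} (h₁ : s < r) (h₂ : r < t) :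
    slope f r t - slope f s t
      = -(((t - r) * (t - s))⁻¹ • ((t - r) • (f r - f s) - (r - s) • (f t - f r))) := by
  have n1 : t - r ≠ 0 := sub_ne_zero.2 h₂.ne'
  have n2 : t - s ≠ 0 := sub_ne_zero.2 (h₁.trans h₂).ne'
  simp only [slope_def_module, mul_inv]
  match_scalars <;> field_simp <;> ring

/-- A curve whose difference quotients over adjacent intervals of comparable lengths are
`1/2`-Hölder close is continuously differentiable. -/
theorem exists_hasDerivWithinAt_of_slope [CompleteSpace E] {f : ℝ → E} {a b A : ℝ} (hA : 0 ≤ A)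
    (hl : ∀ s r t, a ≤ s → s < r → r < t → t ≤ b → t - s ≤ 2 * (r - s) →
      ‖slope f s r - slope f s t‖ ≤ A * √(t - s))
    (hr : ∀ s r t, a ≤ s → s < r → r < t → t ≤ b → t - s ≤ 2 * (t - r) →
      ‖slope f r t - slope f s t‖ ≤ A * √(t - s)) :
    ∃ f' : ℝ → E, ContinuousOn f' (Icc a b) ∧
      ∀ t ∈ Icc a b, HasDerivWithinAt f (f' t) (Icc a b) t := by
  rcases le_or_gt b a with hab | hab
  · refine ⟨0, continuousOn_const, fun t ht ↦ ?_⟩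
    have hsub : Icc a b ⊆ {t} := fun x hx ↦ by
      have := ht.1; have := ht.2; have := hx.1; have := hx.2
      exact le_antisymm (by linarith) (by linarith)
    exact (hasDerivWithinAt_iff_hasFDerivWithinAt.2
      (HasFDerivWithinAt.of_subsingleton (subsingleton_singleton.anti hsub)))
  have hl' : ∀ s r t, a ≤ s → s < r → r ≤ t → t ≤ b →
      ‖slope f s r - slope f s t‖ ≤ 4 * A * √(t - s) := by
    intro s r t h1 h2 h3 h4
    have := norm_sub_le_of_doubling (e := fun h ↦ slope f s (s + h)) (H := b - s) hA
      (fun h₁ h k1 k2 k3 k4 ↦ by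
        rcases k2.eq_or_lt with rfl | k2
        · simpa using mul_nonneg hA (Real.sqrt_nonneg _)
        · simpa using hl s (s + h₁) (s + h) h1 (by linarith) (by linarith) (by linarith)
            (by linarith)) (h₁ := r - s) (h := t - s) (by linarith) (by linarith) (by linarith)
    simpa using this
  have hr' : ∀ s r t, a ≤ s → s ≤ r → r < t → t ≤ b →
      ‖slope f r t - slope f s t‖ ≤ 4 * A * √(t - s) := by
    intro s r t h1 h2 h3 h4
    have := norm_sub_le_of_doubling (e := fun h ↦ slope f (t - h) t) (H := t - a) hA
      (fun h₁ h k1 k2 k3 k4 ↦ by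
        rcases k2.eq_or_lt with rfl | k2
        · simpa using mul_nonneg hA (Real.sqrt_nonneg _)
        · simpa using hr (t - h) (t - h₁) t (by linarith) (by linarith) (by linarith) h4
            (by linarith)) (h₁ := t - r) (h := t - s) (by linarith) (by linarith) (by linarith)
    simpa using this
  -- difference quotients based at a common point
  have hd : ∀ s r t, s ∈ Icc a b → r ∈ Icc a b → t ∈ Icc a b → r ≠ s → t ≠ s →
      ‖slope f s r - slope f s t‖ ≤ 8 * A * √(|r - s| + |t - s|) := by
    have ordered : ∀ s r t, s ∈ Icc a b → r ∈ Icc a b → t ∈ Icc a b → r ≠ s → t ≠ s → r ≤ t →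
        ‖slope f s r - slope f s t‖ ≤ 8 * A * √(|r - s| + |t - s|) := by
      intro s r t hs hr'' ht hrs hts hrt
      have mono : ∀ x, x ≤ |r - s| + |t - s| → 4 * A * √x ≤ 4 * A * √(|r - s| + |t - s|) :=
        fun x hx ↦ by gcongr
      have h0 := mul_nonneg hA (Real.sqrt_nonneg (|r - s| + |t - s|))
      have := le_abs_self (r - s); have := le_abs_self (t - s)
      have := neg_abs_le (r - s); have := neg_abs_le (t - s)
      have := abs_nonneg (r - s); have := abs_nonneg (t - s)
      -- If the base point `s` lies outside the interval from `r` to `t`, one comparison suffices;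
      -- if it lies between them, both slopes are compared with the slope from `r` to `t`.
      rcases lt_or_gt_of_ne hrs with h1 | h1
      · rcases lt_or_gt_of_ne hts with h2 | h2
        · have h3 := hr' r t s hr''.1 hrt h2 hs.2
          have h4 := mono (s - r) (by linarith)
          rw [slope_comm f s r, slope_comm f s t, norm_sub_rev]
          linarith
        · have h3 := hr' r s t hr''.1 h1.le h2 ht.2
          have h4 := hl' r s t hr''.1 h1 h2.le ht.2
          have h5 := mono (t - r) (by linarith)
          have h6 := norm_sub_le_norm_sub_add_norm_sub (slope f r s) (slope f r t) (slope f s t)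
          rw [norm_sub_rev (slope f r t)] at h6
          rw [slope_comm f s r]
          linarith
      · have h3 := hl' s r t hs.1 h1 hrt ht.2
        have h4 := mono (t - s) (by linarith)
        linarith
    intro s r t hs hr'' ht hrs hts
    rcases le_total r t with h | h
    · exact ordered s r t hs hr'' ht hrs hts h
    · rw [norm_sub_rev, add_comm]
      exact ordered s t r hs ht hr'' hts hrs h
  have hlim : ∀ s ∈ Icc a b, ∃ l, Filter.Tendsto (slope f s) (𝓝[Icc a b \ {s}] s) (𝓝 l) := by
    intro s hs
    have : (𝓝[Icc a b \ {s}] s).NeBot := by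
      rw [← accPt_principal_iff_nhdsWithin]
      exact (uniqueDiffOn_Icc hab s hs).accPt
    have hc : Cauchy (Filter.map (slope f s) (𝓝[Icc a b \ {s}] s)) := by
      rw [Metric.cauchy_iff]
      refine ⟨inferInstance, fun ε hε ↦ ?_⟩
      have hcont : Filter.Tendsto (fun x ↦ 8 * A * √(2 * x)) (𝓝 0) (𝓝 0) := by
        have : Continuous fun x : ℝ ↦ 8 * A * √(2 * x) := by fun_prop
        simpa using this.tendsto 0
      obtain ⟨δ, hδ, hδ'⟩ := Metric.eventually_nhds_iff.1 (hcont.eventually_lt_const hε)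
      have hδ2 := hδ' (y := δ / 2) (by
        rw [Real.dist_eq, sub_zero, abs_of_pos (by linarith)]; linarith)
      refine ⟨slope f s '' ((Icc a b \ {s}) ∩ Metric.ball s (δ / 2)),
        Filter.image_mem_map (Filter.inter_mem self_mem_nhdsWithin
          (mem_nhdsWithin_of_mem_nhds (Metric.ball_mem_nhds _ (by linarith)))), ?_⟩
      rintro _ ⟨r, ⟨hr1, hr2⟩, rfl⟩ _ ⟨t, ⟨ht1, ht2⟩, rfl⟩
      rw [dist_eq_norm]
      refine ((hd s r t hs hr1.1 ht1.1 hr1.2 ht1.2).trans ?_).trans_lt hδ2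
      rw [Metric.mem_ball, Real.dist_eq] at hr2 ht2
      gcongr
      linarith
    obtain ⟨l, hl⟩ := CompleteSpace.complete hc
    exact ⟨l, hl⟩
  choose! f' hf' using hlim
  refine ⟨f', ?_, fun t ht ↦ hasDerivWithinAt_iff_tendsto_slope.2 (hf' t ht)⟩
  have hest : ∀ s ∈ Icc a b, ∀ t ∈ Icc a b, t ≠ s →
      ‖f' s - slope f s t‖ ≤ 8 * A * √(|t - s|) := by
    intro s hs t ht hts
    have : (𝓝[Icc a b \ {s}] s).NeBot := by
      rw [← accPt_principal_iff_nhdsWithin]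
      exact (uniqueDiffOn_Icc hab s hs).accPt
    have h1 : Filter.Tendsto (fun r ↦ ‖slope f s r - slope f s t‖) (𝓝[Icc a b \ {s}] s)
      (𝓝 ‖f' s - slope f s t‖) := ((hf' s hs).sub_const _).norm
    have h2 : Filter.Tendsto (fun r ↦ 8 * A * √(|r - s| + |t - s|)) (𝓝[Icc a b \ {s}] s)
      (𝓝 (8 * A * √(|t - s|))) := by
      have : Continuous fun r ↦ 8 * A * √(|r - s| + |t - s|) := by fun_prop
      simpa using (this.tendsto s).mono_left nhdsWithin_le_nhds
    refine le_of_tendsto_of_tendsto h1 h2 ?_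
    filter_upwards [self_mem_nhdsWithin] with r hr
    exact hd s r t hs hr.1 ht hr.2 hts
  intro s hs
  rw [ContinuousWithinAt, tendsto_iff_norm_sub_tendsto_zero]
  have h2 : Filter.Tendsto (fun r ↦ 16 * A * √(|r - s|)) (𝓝[Icc a b] s) (𝓝 0) := by
    have : Continuous fun r ↦ 16 * A * √(|r - s|) := by fun_prop
    simpa using (this.tendsto s).mono_left nhdsWithin_le_nhds
  refine squeeze_zero' (.of_forall fun _ ↦ norm_nonneg _) ?_ h2
  filter_upwards [self_mem_nhdsWithin] with r hr
  by_cases hrs : r = s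
  · simp [hrs]
  -- The slope between `r` and `s` is symmetric and close to both derivatives, so they are close to
  -- each other.
  have h3 := hest s hs r hr hrs
  have h4 := hest r hr s hs (Ne.symm hrs)
  rw [slope_comm, abs_sub_comm] at h4
  have h5 := norm_sub_le_norm_sub_add_norm_sub (f' r) (slope f s r) (f' s)
  rw [norm_sub_rev (slope f s r)] at h5
  linarith

end Slopes

/-! ### Curves that are null to third order are C¹ -/

namespace ConeField

variable {E : Type*} [NormedAddCommGroup E] [NormedSpace ℝ E] {K : ConeField E}

/-- A curve, parametrized by the time function, whose displacements are null up to third order is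
a continuously differentiable null curve. -/
theorem exists_hasDerivWithinAt_of_abs_metric_le [CompleteSpace E] {σ : ℝ → E} {τ δ A : ℝ}
    (hδ : 0 < δ) (hmem : ∀ t ∈ Icc 0 δ, σ t ∈ K.ball) (htime : ∀ t ∈ Icc 0 δ, K.time (σ t) = τ + t)
    (hlip : ∀ s ∈ Icc 0 δ, ∀ t ∈ Icc 0 δ, K.slope * ‖σ t - σ s‖ ≤ |t - s|)
    (hnull : ∀ s ∈ Icc 0 δ, ∀ t ∈ Icc 0 δ,
      |K.metric (σ s) (σ t - σ s) (σ t - σ s)| ≤ A * |t - s| ^ 3) :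
    ∃ σ' : ℝ → E, ContinuousOn σ' (Icc 0 δ) ∧ ∀ t ∈ Icc 0 δ,
      HasDerivWithinAt σ (σ' t) (Icc 0 δ) t ∧ K.metric (σ t) (σ' t) (σ' t) = 0 ∧
        K.time (σ' t) = 1 := by
  have hκ := K.slope_pos
  have hA0 : 0 ≤ A := by
    have h := (abs_nonneg _).trans (hnull 0 (left_mem_Icc.2 hδ.le) δ (right_mem_Icc.2 hδ.le))
    rw [sub_zero] at h
    exact nonneg_of_mul_nonneg_left h (by positivity)
  -- The added term pays for moving the base point of the second chord from `σ r` to `σ s`.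
  set A' := A + K.L / K.slope ^ 3 with hA'
  have hA'0 : 0 ≤ A' := add_nonneg hA0 (div_nonneg K.L_nonneg (by positivity))
  -- weighted second differences
  have second : ∀ s r t, 0 ≤ s → s < r → r < t → t ≤ δ →
      K.c * ‖(t - r) • (σ r - σ s) - (r - s) • (σ t - σ r)‖ ^ 2 ≤ 3 * A' * (t - s) ^ 5 := by
    intro s r t h0 h1 h2 h3
    have hs : s ∈ Icc 0 δ := ⟨h0, by linarith⟩
    have hr : r ∈ Icc 0 δ := ⟨by linarith, by linarith⟩
    have ht : t ∈ Icc 0 δ := ⟨by linarith, h3⟩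
    set x := σ r - σ s with hx
    set z := σ t - σ r with hz
    have hxz : σ t - σ s = x + z := by rw [hx, hz]; abel
    set p := r - s with hp
    set q := t - r with hq
    have hpq : t - s = p + q := by rw [hp, hq]; ring
    have hp0 : 0 < p := by rw [hp]; linarith
    have hq0 : 0 < q := by rw [hq]; linarith
    have e1 := hnull s hs r hr
    have e2 := hnull s hs t ht
    have e3 := hnull r hr t ht
    have e4 := abs_metric_sub_le (hmem s hs) (hmem r hr) z
    have e5 := hlip s hs r hr
    have e6 := hlip r hr t ht
    rw [← hx, ← hp, abs_of_pos hp0] at e1 e5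
    rw [← hz, ← hq, abs_of_pos hq0] at e3 e6
    rw [hxz, hpq, abs_of_pos (add_pos hp0 hq0)] at e2
    rw [norm_sub_rev, ← hx] at e4
    have e7 : K.L * ‖x‖ * ‖z‖ ^ 2 ≤ K.L / K.slope ^ 3 * (p * q ^ 2) := by
      have : K.L * ‖x‖ * ‖z‖ ^ 2
          = K.L / K.slope ^ 3 * ((K.slope * ‖x‖) * (K.slope * ‖z‖) ^ 2) := by field_simp
      have := K.L_nonneg
      rw [‹K.L * ‖x‖ * ‖z‖ ^ 2 = _›]
      gcongr
    have hB : 0 ≤ K.L / K.slope ^ 3 := div_nonneg K.L_nonneg (by positivity)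
    -- The weights are chosen so that `q • x - p • z` has zero time component; coercivity then
    -- bounds its norm by the metric alone. The expansion `c3` involves only the squares of the
    -- three chords, each O(h³), with coefficients O(h²).
    have c1 := K.coercive (σ s) (hmem s hs) (q • x - p • z)
    have c2 : K.time (q • x - p • z) = 0 := by
      simp only [map_sub, map_smul, smul_eq_mul, hx, hz, htime s hs, htime r hr, htime t ht]
      rw [hp, hq]; ring
    have c3 : K.metric (σ s) (q • x - p • z) (q • x - p • z)
        = q * (p + q) * K.metric (σ s) x x + p * (p + q) * K.metric (σ s) z z
          - p * q * K.metric (σ s) (x + z) (x + z) := by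
      simp only [map_add, map_sub, map_smul, smul_eq_mul, _root_.add_apply,
        _root_.sub_apply, _root_.smul_apply, K.symm (σ s) (hmem s hs) z x]
      ring
    have hh : 0 < p + q := add_pos hp0 hq0
    have b1 : K.metric (σ s) x x ≤ A' * (p + q) ^ 3 := by
      refine (abs_le.1 e1).2.trans ?_
      gcongr
      · rw [hA']; linarith
      · linarith
    have b2 : K.metric (σ s) z z ≤ A' * (p + q) ^ 3 := by
      have g1 : q ^ 3 ≤ (p + q) ^ 3 := by gcongr; linarith
      have g2 : p * q ^ 2 ≤ (p + q) ^ 3 := by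
        rw [pow_succ' (p + q)]
        gcongr <;> linarith
      have g3 := mul_le_mul_of_nonneg_left g1 hA0
      have g4 := mul_le_mul_of_nonneg_left g2 hB
      have g5 := (abs_le.1 e4).2
      have g6 := (abs_le.1 e3).2
      rw [hA', add_mul]
      linarith
    have b3 : -K.metric (σ s) (x + z) (x + z) ≤ A' * (p + q) ^ 3 := by
      have g1 : A * (p + q) ^ 3 ≤ A' * (p + q) ^ 3 := by
        gcongr
        rw [hA']; linarith
      linarith [(abs_le.1 e2).1]
    have m1 := mul_le_mul_of_nonneg_left b1 (mul_pos hq0 hh).le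
    have m2 := mul_le_mul_of_nonneg_left b2 (mul_pos hp0 hh).le
    have m3 := mul_le_mul_of_nonneg_left b3 (mul_pos hp0 hq0).le
    have m4 : (q * (p + q) + p * (p + q) + p * q) * (A' * (p + q) ^ 3)
        ≤ 3 * (p + q) ^ 2 * (A' * (p + q) ^ 3) := by
      gcongr
      nlinarith
    rw [c2, c3] at c1
    rw [hpq]
    calc K.c * ‖q • x - p • z‖ ^ 2
        ≤ (q * (p + q) + p * (p + q) + p * q) * (A' * (p + q) ^ 3) := by linarith
      _ ≤ _ := m4
      _ = 3 * A' * (p + q) ^ 5 := by ring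
  -- Dividing a vector of size h^(5/2) by `p * h` with `h ≤ 2 * p` leaves √h; the 12 is 3 · 2².
  have conclude : ∀ (D : E) (p h : ℝ), 0 < p → 0 < h → h ≤ 2 * p →
      K.c * ‖D‖ ^ 2 ≤ 3 * A' * h ^ 5 → ‖(p * h)⁻¹ • D‖ ≤ √(12 * A' / K.c) * √h := by
    intro D p h hp hh hph hD
    have hc := K.c_pos
    rw [← Real.sqrt_mul (by positivity)]
    refine Real.le_sqrt_of_sq_le ?_
    rw [norm_smul, mul_pow, norm_inv, Real.norm_of_nonneg (by positivity), inv_pow,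
      ← div_eq_inv_mul, div_le_iff₀ (by positivity), div_mul_eq_mul_div, div_mul_eq_mul_div,
      le_div_iff₀ hc]
    have h1 : h ^ 2 ≤ 4 * p ^ 2 := by nlinarith
    have h2 := mul_le_mul_of_nonneg_left h1 (show 0 ≤ 3 * A' * h ^ 3 by positivity)
    calc ‖D‖ ^ 2 * K.c ≤ 3 * A' * h ^ 5 := by linarith
      _ = 3 * A' * h ^ 3 * h ^ 2 := by ring
      _ ≤ _ := h2
      _ = _ := by ring
  have hT : ∀ s ∈ Icc 0 δ, ∀ t ∈ Icc 0 δ, t ≠ s → K.time (_root_.slope σ s t) = 1 := by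
    intro s hs t ht hts
    have : t - s ≠ 0 := sub_ne_zero.2 hts
    rw [slope_def_module, map_smul, map_sub, htime s hs, htime t ht, smul_eq_mul]
    field_simp
    ring
  obtain ⟨σ', hcont, hder⟩ := exists_hasDerivWithinAt_of_slope (f := σ) (a := 0) (b := δ)
    (Real.sqrt_nonneg (12 * A' / K.c))
    (fun s r t h0 h1 h2 h3 h4 ↦ by
      rw [slope_sub_slope_left σ h1 h2]
      exact conclude _ (r - s) (t - s) (by linarith) (by linarith) h4 (second s r t h0 h1 h2 h3))
    (fun s r t h0 h1 h2 h3 h4 ↦ by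
      rw [slope_sub_slope_right σ h1 h2, norm_neg]
      exact conclude _ (t - r) (t - s) (by linarith) (by linarith) h4 (second s r t h0 h1 h2 h3))
  refine ⟨σ', hcont, fun t ht ↦ ?_⟩
  have hlim := hasDerivWithinAt_iff_tendsto_slope.1 (hder t ht)
  have : (𝓝[Icc 0 δ \ {t}] t).NeBot := by
    rw [← accPt_principal_iff_nhdsWithin]
    exact (uniqueDiffOn_Icc hδ t ht).accPt
  refine ⟨hder t ht, ?_, ?_⟩
  · have h1 : Filter.Tendsto
        (fun r ↦ K.metric (σ t) (_root_.slope σ t r) (_root_.slope σ t r))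
        (𝓝[Icc 0 δ \ {t}] t) (𝓝 (K.metric (σ t) (σ' t) (σ' t))) := by
      have : Continuous fun v ↦ K.metric (σ t) v v := by fun_prop
      exact (this.tendsto _).comp hlim
    refine tendsto_nhds_unique h1 ?_
    have h2 : Filter.Tendsto (fun r ↦ A * |r - t|) (𝓝[Icc 0 δ \ {t}] t) (𝓝 0) := by
      have : Continuous fun r ↦ A * |r - t| := by fun_prop
      simpa using (this.tendsto t).mono_left nhdsWithin_le_nhds
    refine squeeze_zero_norm' ?_ h2
    filter_upwards [self_mem_nhdsWithin] with r hr
    have h3 := hnull t ht r hr.1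
    have h4 : 0 < |r - t| := abs_pos.2 (sub_ne_zero.2 hr.2)
    rw [slope_def_module]
    simp only [map_smul, _root_.smul_apply, smul_eq_mul, Real.norm_eq_abs, abs_mul, abs_inv]
    calc |r - t|⁻¹ * (|r - t|⁻¹ * |K.metric (σ t) (σ r - σ t) (σ r - σ t)|)
        ≤ |r - t|⁻¹ * (|r - t|⁻¹ * (A * |r - t| ^ 3)) := by gcongr
      _ = A * |r - t| := by field_simp
  · refine tendsto_nhds_unique ((K.time.continuous.tendsto _).comp hlim) ?_
    refine (tendsto_const_nhds (x := (1 : ℝ))).congr' ?_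
    filter_upwards [self_mem_nhdsWithin] with r hr
    exact (hT t ht r hr.1 hr.2).symm

end ConeField

/-! ### Charts in which the metric is a cone field -/

namespace TimeOrientedLorentzianMetric

variable {n : ℕ} {k : ℕ∞} {M : Type*} [TopologicalSpace M]
  [ChartedSpace (EuclideanSpace ℝ (Fin n)) M] [IsManifold (𝓡 n) 1 M]

/-- A ball in the preferred chart at `y` on which the metric is a cone field. -/
structure LorentzChart (S : TimeOrientedLorentzianMetric n k M) (y : M) extends
    ConeField (EuclideanSpace ℝ (Fin n)) where
  center_eq : center = extChartAt (𝓡 n) y y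
  ball_subset : toConeField.ball ⊆ (extChartAt (𝓡 n) y).target
  metric_apply : ∀ m ∈ (extChartAt (𝓡 n) y).source, ∀ v w : TangentSpace (𝓡 n) m,
    metric (extChartAt (𝓡 n) y m) (coord y m v) (coord y m w) = S.g m v w
  isFutureTimelike_iff : ∀ m ∈ (extChartAt (𝓡 n) y).source,
    extChartAt (𝓡 n) y m ∈ toConeField.ball → ∀ v : TangentSpace (𝓡 n) m,
    S.IsFutureTimelike v ↔ toConeField.Timelike (extChartAt (𝓡 n) y m) (coord y m v)
  isFutureCausal_of : ∀ m ∈ (extChartAt (𝓡 n) y).source,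
    extChartAt (𝓡 n) y m ∈ toConeField.ball → ∀ v : TangentSpace (𝓡 n) m,
    metric (extChartAt (𝓡 n) y m) (coord y m v) (coord y m v) ≤ 0 → 0 < time (coord y m v) →
    S.IsFutureCausal v

theorem isLorentzianForm_coordMetric (S : TimeOrientedLorentzianMetric n k M) {y m : M}
    (hm : m ∈ (extChartAt (𝓡 n) y).source) :
    IsLorentzianForm (S.coordMetric y (extChartAt (𝓡 n) y m)) := by
  have hs := (coord_bijective (n := n) hm).2
  obtain ⟨hsymm, v, hv, hpos⟩ := S.lorentzian m
  refine ⟨fun a b ↦ ?_, coord y m v, ?_, fun w hw hw0 ↦ ?_⟩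
  · obtain ⟨a, rfl⟩ := hs a
    obtain ⟨b, rfl⟩ := hs b
    rw [S.coordMetric_apply hm, S.coordMetric_apply hm, hsymm]
  · rwa [S.coordMetric_apply hm]
  · obtain ⟨w, rfl⟩ := hs w
    rw [S.coordMetric_apply hm] at hw ⊢
    exact hpos w hw (by rintro rfl; simp at hw0)

set_option synthInstance.maxHeartbeats 200000 in
-- The time functional is minus the metric dual of the orienting field, frozen at `y`. Coercivity at
-- the centre survives with `c / 2` where the metric moves by less than `c / 2`, and a C¹ metric is
-- locally Lipschitz. Causal vectors satisfy `κ * ‖v‖ ≤ |time v|`, so where the dual of the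
-- orienting field moves by less than `κ / 2`, the frozen functional still decides which of them are
-- future-directed.
theorem exists_lorentzChart (S : TimeOrientedLorentzianMetric n k M) (hk : 1 ≤ k) (y : M) {ε : ℝ}
    (hε : 0 < ε) : ∃ K : S.LorentzChart y, K.radius ≤ ε := by
  set φ := extChartAt (𝓡 n) y with hφ
  set p := φ y with hp
  set G := S.coordMetric y with hG
  have hy : y ∈ φ.source := mem_extChartAt_source y
  set ξ : M → EuclideanSpace ℝ (Fin n) := fun m ↦ coord y m (S.X m) with hξ
  have hb := S.isLorentzianForm_coordMetric hy
  have hX : G p (ξ y) (ξ y) < 0 := by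
    rw [hG, hp, hξ, S.coordMetric_apply hy]; exact S.timelike_X y
  obtain ⟨c, hc, C, hC, hcoer⟩ := hb.exists_coercive hX
  have hdiff : ContDiffAt ℝ 1 G p := (S.contDiffAt_coordMetric y).of_le (by exact_mod_cast hk)
  obtain ⟨L, U, hU, hL⟩ := hdiff.exists_lipschitzOnWith
  set κ := √(c / 2 / C) with hκ
  have hκ0 : 0 < κ := Real.sqrt_pos.2 (by positivity)
  have h1 : ∀ᶠ u in 𝓝 p, ‖G u - G p‖ < c / 2 := by
    exact (tendsto_iff_norm_sub_tendsto_zero.1 hdiff.continuousAt.tendsto).eventually_lt_const (by positivity)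
  have h2 : ∀ᶠ m in 𝓝 y, ‖G (φ m) (ξ m) - G p (ξ y)‖ < κ / 2 := by
    have hc1 : ContinuousAt (fun m ↦ G (φ m)) y :=
      ContinuousAt.comp (g := G) (f := φ) hdiff.continuousAt (continuousAt_extChartAt y)
    have hc2 : ContinuousAt (fun m ↦ G (φ m) (ξ m)) y := hc1.clm_apply (S.continuousAt_coord_X y)
    exact (tendsto_iff_norm_sub_tendsto_zero.1 hc2.tendsto).eventually_lt_const (by positivity)
  have h3 : ∀ᶠ u in 𝓝 p, ‖G (φ (φ.symm u)) (ξ (φ.symm u)) - G p (ξ y)‖ < κ / 2 := by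
    have hc : Filter.Tendsto φ.symm (𝓝 p) (𝓝 y) := by
      have := (continuousAt_extChartAt_symm (I := 𝓡 n) y).tendsto
      rwa [extChartAt_to_inv] at this
    exact hc.eventually h2
  have h4 : φ.target ∈ 𝓝 p := extChartAt_target_mem_nhds y
  obtain ⟨ρ, hρ, hball⟩ := Metric.mem_nhds_iff.1 (Filter.inter_mem hU
    (Filter.inter_mem h1 (Filter.inter_mem h3 h4)))
  have hsub : Metric.ball p (min ρ ε) ⊆ Metric.ball p ρ := Metric.ball_subset_ball (min_le_left _ _)
  have hsource : ∀ m ∈ φ.source, φ m ∈ Metric.ball p (min ρ ε) →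
      ‖G (φ m) (ξ m) - G p (ξ y)‖ < κ / 2 := by
    intro m hm hmb
    have := (hball (hsub hmb)).2.2.1
    rw [mem_ofPred_eq, φ.left_inv hm] at this
    exact this
  have hcoer' : ∀ u ∈ Metric.ball p (min ρ ε), ∀ v,
      c / 2 * ‖v‖ ^ 2 ≤ G u v v + C * ((-(G p (ξ y))) v) ^ 2 := by
    intro u hu v
    have e1 : ‖G u - G p‖ < c / 2 := (hball (hsub hu)).2.1
    have e2 := (G u - G p).le_opNorm₂ v v
    have e3 : ‖G u - G p‖ * ‖v‖ * ‖v‖ ≤ c / 2 * ‖v‖ ^ 2 := by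
      rw [mul_assoc, ← sq]; gcongr
    have e4 := neg_abs_le (G u v v - G p v v)
    have e5 := hcoer v
    simp only [sub_apply, Real.norm_eq_abs] at e2
    simp only [neg_apply, neg_sq]
    linarith
  have hslope : ∀ u ∈ Metric.ball p (min ρ ε), ∀ v, G u v v ≤ 0 →
      κ * ‖v‖ ≤ |(-(G p (ξ y))) v| := by
    intro u hu v hv
    have e := hcoer' u hu v
    refine abs_le_of_sq_le_sq' ?_ (abs_nonneg _) |>.2
    rw [mul_pow, hκ, Real.sq_sqrt (by positivity), sq_abs, div_mul_eq_mul_div, div_le_iff₀ hC]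
    linarith
  have hsign : ∀ m ∈ φ.source, φ m ∈ Metric.ball p (min ρ ε) → ∀ v : TangentSpace (𝓡 n) m,
      v ≠ 0 → G (φ m) (coord y m v) (coord y m v) ≤ 0 →
      (S.g m (S.X m) v < 0 ↔ 0 < (-(G p (ξ y))) (coord y m v)) := by
    intro m hm hmb v hv0 hv
    have e0 : coord y m v ≠ 0 := fun h ↦ hv0 ((coord_bijective hm).1 (by rw [h, map_zero]))
    have e1 := hslope _ hmb _ hv
    have e2 := (G (φ m) (ξ m) - G p (ξ y)).le_opNorm (coord y m v)
    have e3 : 0 < ‖coord y m v‖ := norm_pos_iff.2 e0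
    have e4 := mul_lt_mul_of_pos_right (hsource m hm hmb) e3
    have e5 : G (φ m) (ξ m) (coord y m v) = S.g m (S.X m) v := S.coordMetric_apply hm _ _
    have e6 := mul_pos hκ0 e3
    simp only [sub_apply, Real.norm_eq_abs, e5] at e2
    simp only [neg_apply, abs_neg] at e1 ⊢
    have e7 := abs_le.1 e2
    constructor
    · intro h
      by_contra! h'
      rw [abs_of_nonneg (by linarith)] at e1
      linarith
    · intro h
      rw [abs_of_neg (by linarith)] at e1
      linarith
  refine ⟨{
    metric := G
    time := -(G p (ξ y))
    center := p
    radius := min ρ ε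
    c := c / 2
    C := C
    L := L
    radius_pos := lt_min hρ hε
    c_pos := by positivity
    C_pos := hC
    L_nonneg := L.2
    symm := fun u hu ↦ by
      have ht := (hball (hsub hu)).2.2.2
      have := (S.isLorentzianForm_coordMetric (φ.map_target ht)).1
      rwa [φ.right_inv ht] at this
    coercive := hcoer'
    lipschitz := fun u hu w hw ↦ hL.norm_sub_le (hball (hsub hu)).1 (hball (hsub hw)).1
    center_eq := rfl
    ball_subset := fun u hu ↦ (hball (hsub hu)).2.2.2
    metric_apply := fun m hm v w ↦ S.coordMetric_apply hm v w
    isFutureTimelike_iff := fun m hm hmb v ↦ ?_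
    isFutureCausal_of := fun m hm hmb v hv hT ↦ ?_ }, min_le_right _ _⟩
  · have e : G (φ m) (coord y m v) (coord y m v) = S.g m v v := S.coordMetric_apply hm v v
    change _ ∧ _ ↔ G (φ m) (coord y m v) (coord y m v) < 0 ∧ _
    rw [e]
    refine and_congr_right fun h ↦ hsign m hm hmb v ?_ (by rw [e]; exact h.le)
    rintro rfl
    simp at h
  · have hv0 : v ≠ 0 := by
      rintro rfl
      simp at hT
    refine ⟨hv0, ?_, (hsign m hm hmb v hv0 hv).2 hT⟩
    rw [← S.coordMetric_apply hm]
    exact hv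

end TimeOrientedLorentzianMetric

/-! ### Arcs built in charts and openness of the chronological relation -/

namespace ConeField

variable {E : Type*} [NormedAddCommGroup E] [NormedSpace ℝ E] {K : ConeField E}

theorem Timelike.smul {u v : E} (h : K.Timelike u v) {a : ℝ} (ha : 0 < a) :
    K.Timelike u (a • v) := by
  refine ⟨?_, ?_⟩
  · simp only [map_smul, _root_.smul_apply, smul_eq_mul]
    exact mul_neg_of_pos_of_neg ha (mul_neg_of_pos_of_neg ha h.1)
  · rw [map_smul, smul_eq_mul]
    exact mul_pos ha h.2

set_option synthInstance.maxHeartbeats 100000 in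
variable (K) in
theorem continuousAt_metric {u : E} (hu : u ∈ K.ball) : ContinuousAt K.metric u := by
  refine (tendsto_iff_norm_sub_tendsto_zero (E := E →L[ℝ] E →L[ℝ] ℝ)).2 ?_
  have h : Filter.Tendsto (fun w ↦ K.L * ‖w - u‖) (𝓝 u) (𝓝 0) := by
    have : Continuous fun w ↦ K.L * ‖w - u‖ := by fun_prop
    simpa using this.tendsto u
  refine squeeze_zero' (.of_forall fun _ ↦ by positivity) ?_ h
  filter_upwards [Metric.isOpen_ball.mem_nhds hu] with w hw
  exact K.lipschitz w hw u hu

variable (K) in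
theorem eventually_timelike {u v : E} (hu : u ∈ K.ball) (hv : K.Timelike u v) :
    ∀ᶠ p : E × E in 𝓝 (u, v), K.Timelike p.1 p.2 := by
  have h1 : ContinuousAt (fun p : E × E ↦ K.metric p.1 p.2 p.2) (u, v) :=
    ((ContinuousAt.comp (g := K.metric) (K.continuousAt_metric hu) continuousAt_fst).clm_apply
      continuousAt_snd).clm_apply continuousAt_snd
  have h2 : Continuous fun p : E × E ↦ K.time p.2 := by fun_prop
  exact (h1.tendsto.eventually_lt_const hv.1).and ((h2.tendsto (u, v)).eventually_const_lt hv.2)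

end ConeField

namespace TimeOrientedLorentzianMetric

variable {n : ℕ} {k : ℕ∞} {M : Type*} [TopologicalSpace M]
  [ChartedSpace (EuclideanSpace ℝ (Fin n)) M] [IsManifold (𝓡 n) 1 M]
  {S : TimeOrientedLorentzianMetric n k M}

theorem IsFutureTimelike.smul {m : M} {v : TangentSpace (𝓡 n) m} (hv : S.IsFutureTimelike v)
    {a : ℝ} (ha : 0 < a) : S.IsFutureTimelike (a • v) := by
  obtain ⟨h1, h2⟩ := hv
  refine ⟨?_, ?_⟩
  · have h : S.g m (a • v) (a • v) = a * (a * S.g m v v) := by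
      rw [map_smul, smul_eq_mul, (S.g m).map_smul]
      rfl
    rw [h]
    exact mul_neg_of_pos_of_neg ha (mul_neg_of_pos_of_neg ha h1)
  · rw [map_smul, smul_eq_mul]
    exact mul_neg_of_pos_of_neg ha h2

theorem IsFutureTimelike.isFutureCausal {m : M} {v : TangentSpace (𝓡 n) m}
    (hv : S.IsFutureTimelike v) : S.IsFutureCausal v := by
  refine ⟨?_, hv.1.le, hv.2⟩
  rintro rfl
  simpa using hv.1

theorem TimelikeArc.causalArc {x y : M} (h : S.TimelikeArc x y) : S.CausalArc x y := by
  obtain ⟨γ, h1, h2, h3, h4⟩ := h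
  exact ⟨γ, h1, h2, h3, fun t ht ↦ (h4 t ht).isFutureCausal⟩

theorem Chron.causal {x y : M} (h : S.Chron x y) : S.Causal x y :=
  Relation.ReflTransGen.mono (fun _ _ ↦ TimelikeArc.causalArc) _ _ h.to_reflTransGen

theorem timelikeArc_of_mem_Icc {γ : ℝ → M} (hγ : ContMDiffOn 𝓘(ℝ, ℝ) (𝓡 n) 1 γ (Icc 0 1))
    (hv : ∀ t ∈ Icc (0 : ℝ) 1, S.IsFutureTimelike (velocity (n := n) γ t)) {a b : ℝ} (ha : 0 ≤ a)
    (hab : a < b) (hb : b ≤ 1) : S.TimelikeArc (γ a) (γ b) := by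
  set ℓ : ℝ → ℝ := fun s ↦ a + (b - a) * s with hℓ
  have hmaps : MapsTo ℓ (Icc 0 1) (Icc 0 1) := fun s hs ↦ by
    have h1 := mul_nonneg (sub_pos.2 hab).le hs.1
    have h2 := mul_le_mul_of_nonneg_left hs.2 (sub_pos.2 hab).le
    simp only [hℓ, mem_Icc]
    constructor <;> linarith
  have hsmooth : ContDiff ℝ 1 ℓ := by fun_prop
  refine ⟨γ ∘ ℓ, hγ.comp hsmooth.contMDiff.contMDiffOn hmaps, by simp [hℓ], by simp [hℓ], ?_⟩
  intro t ht
  have h1 := ((hγ _ (hmaps ht)).mdifferentiableWithinAt one_ne_zero).hasMFDerivWithinAt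
  have h2 : HasDerivWithinAt ℓ (b - a) (Icc 0 1) t := by
    have h := (((hasDerivAt_id t).const_mul (b - a)).const_add a).hasDerivWithinAt (s := Icc 0 1)
    rwa [mul_one] at h
  have h3 := h1.comp t (hasMFDerivWithinAt_iff_hasFDerivWithinAt.2 h2.hasFDerivWithinAt) hmaps
  have h4 := h3.mfderivWithin ((uniqueDiffOn_Icc one_pos t ht).uniqueMDiffWithinAt)
  have h5 : velocity (n := n) (γ ∘ ℓ) t = (b - a) • velocity (n := n) γ (ℓ t) := by
    have h6 : velocity (n := n) (γ ∘ ℓ) t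
        = mfderivWithin 𝓘(ℝ, ℝ) (𝓡 n) γ (Icc 0 1) (ℓ t) ((1 : ℝ) • (b - a)) := congr($h4 (1 : ℝ))
    rw [h6, smul_eq_mul, mul_comm]
    exact (mfderivWithin 𝓘(ℝ, ℝ) (𝓡 n) γ (Icc 0 1) (ℓ t)).map_smul (b - a) (1 : ℝ)
  rw [h5]
  exact (hv _ (hmaps ht)).smul (sub_pos.2 hab)

/-- A continuously differentiable curve in the coordinate ball, seen in the manifold. -/
theorem LorentzChart.contMDiffOn_symm_comp {y : M} (K : S.LorentzChart y)
    {c c' : ℝ → EuclideanSpace ℝ (Fin n)} (hc' : ContinuousOn c' (Icc 0 1))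
    (hc : ∀ t ∈ Icc (0 : ℝ) 1, HasDerivWithinAt c (c' t) (Icc 0 1) t ∧ c t ∈ K.ball) :
    ContMDiffOn 𝓘(ℝ, ℝ) (𝓡 n) 1 ((extChartAt (𝓡 n) y).symm ∘ c) (Icc 0 1) ∧
      ∀ t ∈ Icc (0 : ℝ) 1, coord y ((extChartAt (𝓡 n) y).symm (c t))
        (velocity (n := n) ((extChartAt (𝓡 n) y).symm ∘ c) t) = c' t := by
  have hsmooth : ContDiffOn ℝ 1 c (Icc 0 1) := by
    refine (contDiffOn_one_iff_derivWithin (uniqueDiffOn_Icc zero_lt_one)).2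
      ⟨fun t ht ↦ (hc t ht).1.differentiableWithinAt, hc'.congr fun t ht ↦ ?_⟩
    exact (hc t ht).1.derivWithin (uniqueDiffOn_Icc one_pos t ht)
  have h1 : ContMDiffOn 𝓘(ℝ, ℝ) (𝓡 n) 1 ((extChartAt (𝓡 n) y).symm ∘ c) (Icc 0 1) :=
    (contMDiffOn_extChartAt_symm y).comp hsmooth.contMDiffOn
      (fun t ht ↦ K.ball_subset (hc t ht).2)
  refine ⟨h1, fun t ht ↦ ?_⟩
  have hu := uniqueDiffOn_Icc (zero_lt_one (α := ℝ)) t ht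
  have h2 := hasDerivWithinAt_extChartAt_comp (y := y) h1 ht
    ((extChartAt (𝓡 n) y).map_target (K.ball_subset (hc t ht).2))
  have h3 : HasDerivWithinAt (fun s ↦ extChartAt (𝓡 n) y
      (((extChartAt (𝓡 n) y).symm ∘ c) s)) (c' t) (Icc 0 1) t :=
    (hc t ht).1.congr (fun s hs ↦ (extChartAt (𝓡 n) y).right_inv (K.ball_subset (hc s hs).2))
      ((extChartAt (𝓡 n) y).right_inv (K.ball_subset (hc t ht).2))
  exact hu.eq_deriv _ h2 h3

theorem LorentzChart.timelikeArc {y : M} (K : S.LorentzChart y)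
    {c c' : ℝ → EuclideanSpace ℝ (Fin n)} (hc' : ContinuousOn c' (Icc 0 1))
    (hc : ∀ t ∈ Icc (0 : ℝ) 1, HasDerivWithinAt c (c' t) (Icc 0 1) t ∧ c t ∈ K.ball)
    (ht : ∀ t ∈ Icc (0 : ℝ) 1, K.Timelike (c t) (c' t)) :
    S.TimelikeArc ((extChartAt (𝓡 n) y).symm (c 0)) ((extChartAt (𝓡 n) y).symm (c 1)) := by
  obtain ⟨h1, h2⟩ := K.contMDiffOn_symm_comp hc' hc
  refine ⟨_, h1, rfl, rfl, fun t h ↦ ?_⟩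
  have hm := K.ball_subset (hc t h).2
  have e : extChartAt (𝓡 n) y ((extChartAt (𝓡 n) y).symm (c t)) = c t :=
    (extChartAt (𝓡 n) y).right_inv hm
  refine (K.isFutureTimelike_iff _ ((extChartAt (𝓡 n) y).map_target hm) ?_ _).2 ?_
  · rw [e]; exact (hc t h).2
  · rw [e, h2 t h]
    exact ht t h

theorem LorentzChart.causalArc {y : M} (K : S.LorentzChart y)
    {c c' : ℝ → EuclideanSpace ℝ (Fin n)} (hc' : ContinuousOn c' (Icc 0 1))
    (hc : ∀ t ∈ Icc (0 : ℝ) 1, HasDerivWithinAt c (c' t) (Icc 0 1) t ∧ c t ∈ K.ball)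
    (ht : ∀ t ∈ Icc (0 : ℝ) 1, K.metric (c t) (c' t) (c' t) ≤ 0 ∧ 0 < K.time (c' t)) :
    S.CausalArc ((extChartAt (𝓡 n) y).symm (c 0)) ((extChartAt (𝓡 n) y).symm (c 1)) := by
  obtain ⟨h1, h2⟩ := K.contMDiffOn_symm_comp hc' hc
  refine ⟨_, h1, rfl, rfl, fun t h ↦ ?_⟩
  have hm := K.ball_subset (hc t h).2
  have e : extChartAt (𝓡 n) y ((extChartAt (𝓡 n) y).symm (c t)) = c t :=
    (extChartAt (𝓡 n) y).right_inv hm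
  refine K.isFutureCausal_of _ ((extChartAt (𝓡 n) y).map_target hm) ?_ _ ?_ ?_
  · rw [e]; exact (hc t h).2
  · rw [e, h2 t h]
    exact (ht t h).1
  · rw [h2 t h]
    exact (ht t h).2

theorem LorentzChart.timelikeArc_of_segment {y : M} (K : S.LorentzChart y)
    {a b : EuclideanSpace ℝ (Fin n)} (ha : a ∈ K.ball) (hb : b ∈ K.ball)
    (h : ∀ u ∈ segment ℝ a b, K.Timelike u (b - a)) :
    S.TimelikeArc ((extChartAt (𝓡 n) y).symm a) ((extChartAt (𝓡 n) y).symm b) := by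
  have hseg : ∀ t ∈ Icc (0 : ℝ) 1, AffineMap.lineMap a b t ∈ segment ℝ a b := fun t ht ↦ by
    rw [segment_eq_image_lineMap]; exact mem_image_of_mem _ ht
  have := K.timelikeArc (c := AffineMap.lineMap a b) (c' := fun _ ↦ b - a) continuousOn_const
    (fun t ht ↦ ⟨AffineMap.hasDerivWithinAt_lineMap,
      (convex_ball _ _).segment_subset ha hb (hseg t ht)⟩) (fun t ht ↦ h _ (hseg t ht))
  simpa using this

/-- Points near the centre whose displacement is close to a timelike vector are joined by a
timelike arc. -/
theorem LorentzChart.exists_timelikeArc_of_near {y : M} (K : S.LorentzChart y)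
    {v : EuclideanSpace ℝ (Fin n)} (hv : K.Timelike K.center v) :
    ∃ ε > 0, ∀ a ∈ Metric.ball K.center ε, ∀ b ∈ Metric.ball K.center ε, ∀ l > 0,
      ‖(l⁻¹ : ℝ) • (b - a) - v‖ < ε →
      S.TimelikeArc ((extChartAt (𝓡 n) y).symm a) ((extChartAt (𝓡 n) y).symm b) := by
  have h1 := K.eventually_timelike (Metric.mem_ball_self K.radius_pos) hv
  rw [Metric.eventually_nhds_iff] at h1
  obtain ⟨ε, hε, h⟩ := h1
  refine ⟨min ε K.radius, lt_min hε K.radius_pos, fun a ha b hb l hl hab ↦ ?_⟩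
  have hsub : Metric.ball K.center (min ε K.radius) ⊆ K.ball :=
    Metric.ball_subset_ball (min_le_right _ _)
  refine K.timelikeArc_of_segment (hsub ha) (hsub hb) fun u hu ↦ ?_
  have hu' := (convex_ball K.center (min ε K.radius)).segment_subset ha hb hu
  have h2 : K.Timelike u ((l⁻¹ : ℝ) • (b - a)) := h (y := (u, (l⁻¹ : ℝ) • (b - a))) (by
    rw [Prod.dist_eq, max_lt_iff]
    refine ⟨(Metric.mem_ball.1 hu').trans_le (min_le_left _ _), ?_⟩
    rw [dist_eq_norm]
    exact hab.trans_le (min_le_left _ _))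
  have h3 := h2.smul hl
  rwa [smul_smul, mul_inv_cancel₀ hl.ne', one_smul] at h3

/-- The last piece of the arc is replaced by a coordinate segment to `q'`. For `s` close to 1 the
chord from `γ s` to `γ 1`, divided by `1 - s`, is close to the timelike final velocity; with `s`
fixed this persists when the endpoint moves slightly. -/
theorem TimelikeArc.eventually_chron_right (hk : 1 ≤ k) {p q : M} (h : S.TimelikeArc p q) :
    ∀ᶠ q' in 𝓝 q, S.Chron p q' := by
  obtain ⟨γ, hγ, rfl, rfl, hv⟩ := h
  obtain ⟨K, -⟩ := S.exists_lorentzChart hk (γ 1) one_pos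
  have h1 : (1 : ℝ) ∈ Icc (0 : ℝ) 1 := right_mem_Icc.2 zero_le_one
  have hs := mem_extChartAt_source (I := 𝓡 n) (γ 1)
  have hball : extChartAt (𝓡 n) (γ 1) (γ 1) ∈ K.ball :=
    K.center_eq ▸ Metric.mem_ball_self K.radius_pos
  have ht := (K.isFutureTimelike_iff _ hs hball _).1 (hv 1 h1)
  rw [← K.center_eq] at ht
  obtain ⟨ε, hε, harc⟩ := K.exists_timelikeArc_of_near ht
  have hd := hasDerivWithinAt_extChartAt_comp hγ h1 hs
  set c : ℝ → EuclideanSpace ℝ (Fin n) := fun s ↦ extChartAt (𝓡 n) (γ 1) (γ s) with hc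
  have hc1 : c 1 = K.center := K.center_eq.symm
  have e1 := (hasDerivWithinAt_iff_tendsto_slope.1 hd).eventually (Metric.ball_mem_nhds _ hε)
  have e2 : ∀ᶠ s in 𝓝[Icc 0 1 \ {1}] (1 : ℝ), c s ∈ Metric.ball K.center ε :=
    (hd.continuousWithinAt.mono sdiff_subset).eventually
      (hc1 ▸ Metric.ball_mem_nhds _ hε)
  have e3 : ∀ᶠ s in 𝓝[Icc 0 1 \ {1}] (1 : ℝ), γ s ∈ (extChartAt (𝓡 n) (γ 1)).source :=
    ((hγ.continuousOn 1 h1).mono sdiff_subset).eventually (extChartAt_source_mem_nhds _)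
  have e4 : ∀ᶠ s in 𝓝[Icc 0 1 \ {1}] (1 : ℝ), 0 < s :=
    nhdsWithin_le_nhds (lt_mem_nhds one_pos)
  have : (𝓝[Icc 0 1 \ {1}] (1 : ℝ)).NeBot := by
    rw [← accPt_principal_iff_nhdsWithin]
    exact (uniqueDiffOn_Icc zero_lt_one 1 h1).accPt
  obtain ⟨s, s1, s2, s3, s4, s5⟩ :=
    (e1.and (e2.and (e3.and (e4.and self_mem_nhdsWithin)))).exists
  have hs1 : s < 1 := lt_of_le_of_ne s5.1.2 s5.2
  have near : ∀ᶠ b in 𝓝 K.center, b ∈ Metric.ball K.center ε ∧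
      ‖(1 - s)⁻¹ • (b - c s) - coord (γ 1) (γ 1) (velocity γ 1)‖ < ε := by
    refine Filter.Eventually.and (Metric.ball_mem_nhds _ hε) ?_
    have hcont : Continuous fun b ↦
      ‖(1 - s)⁻¹ • (b - c s) - coord (γ 1) (γ 1) (velocity γ 1)‖ := by fun_prop
    refine (hcont.tendsto _).eventually_lt_const ?_
    rw [dist_eq_norm, slope_comm, slope_def_module, hc1] at s1
    exact s1
  rw [K.center_eq] at near
  filter_upwards [(continuousAt_extChartAt (I := 𝓡 n) (γ 1)).eventually near,
    extChartAt_source_mem_nhds (I := 𝓡 n) (γ 1)] with q' hq' hq's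
  have h2 := harc (c s) s2 _ (K.center_eq ▸ hq'.1) (1 - s) (sub_pos.2 hs1) hq'.2
  rw [hc, (extChartAt (𝓡 n) (γ 1)).left_inv s3, (extChartAt (𝓡 n) (γ 1)).left_inv hq's] at h2
  exact .tail (.single (timelikeArc_of_mem_Icc hγ hv le_rfl s4 s5.1.2)) h2

theorem TimelikeArc.eventually_chron_left (hk : 1 ≤ k) {p q : M} (h : S.TimelikeArc p q) :
    ∀ᶠ p' in 𝓝 p, S.Chron p' q := by
  obtain ⟨γ, hγ, rfl, rfl, hv⟩ := h
  obtain ⟨K, -⟩ := S.exists_lorentzChart hk (γ 0) one_pos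
  have h1 : (0 : ℝ) ∈ Icc (0 : ℝ) 1 := left_mem_Icc.2 zero_le_one
  have hs := mem_extChartAt_source (I := 𝓡 n) (γ 0)
  have hball : extChartAt (𝓡 n) (γ 0) (γ 0) ∈ K.ball :=
    K.center_eq ▸ Metric.mem_ball_self K.radius_pos
  have ht := (K.isFutureTimelike_iff _ hs hball _).1 (hv 0 h1)
  rw [← K.center_eq] at ht
  obtain ⟨ε, hε, harc⟩ := K.exists_timelikeArc_of_near ht
  have hd := hasDerivWithinAt_extChartAt_comp hγ h1 hs
  set c : ℝ → EuclideanSpace ℝ (Fin n) := fun s ↦ extChartAt (𝓡 n) (γ 0) (γ s) with hc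
  have hc1 : c 0 = K.center := K.center_eq.symm
  have e1 := (hasDerivWithinAt_iff_tendsto_slope.1 hd).eventually (Metric.ball_mem_nhds _ hε)
  have e2 : ∀ᶠ s in 𝓝[Icc 0 1 \ {0}] (0 : ℝ), c s ∈ Metric.ball K.center ε :=
    (hd.continuousWithinAt.mono sdiff_subset).eventually
      (hc1 ▸ Metric.ball_mem_nhds _ hε)
  have e3 : ∀ᶠ s in 𝓝[Icc 0 1 \ {0}] (0 : ℝ), γ s ∈ (extChartAt (𝓡 n) (γ 0)).source :=
    ((hγ.continuousOn 0 h1).mono sdiff_subset).eventually (extChartAt_source_mem_nhds _)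
  have e4 : ∀ᶠ s in 𝓝[Icc 0 1 \ {0}] (0 : ℝ), s < 1 :=
    nhdsWithin_le_nhds (gt_mem_nhds one_pos)
  have : (𝓝[Icc 0 1 \ {0}] (0 : ℝ)).NeBot := by
    rw [← accPt_principal_iff_nhdsWithin]
    exact (uniqueDiffOn_Icc zero_lt_one 0 h1).accPt
  obtain ⟨s, s1, s2, s3, s4, s5⟩ :=
    (e1.and (e2.and (e3.and (e4.and self_mem_nhdsWithin)))).exists
  have hs1 : 0 < s := lt_of_le_of_ne s5.1.1 (Ne.symm s5.2)
  have near : ∀ᶠ b in 𝓝 K.center, b ∈ Metric.ball K.center ε ∧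
      ‖s⁻¹ • (c s - b) - coord (γ 0) (γ 0) (velocity γ 0)‖ < ε := by
    refine Filter.Eventually.and (Metric.ball_mem_nhds _ hε) ?_
    have hcont : Continuous fun b ↦
      ‖s⁻¹ • (c s - b) - coord (γ 0) (γ 0) (velocity γ 0)‖ := by fun_prop
    refine (hcont.tendsto _).eventually_lt_const ?_
    rw [dist_eq_norm, slope_def_module, hc1, sub_zero] at s1
    exact s1
  rw [K.center_eq] at near
  filter_upwards [(continuousAt_extChartAt (I := 𝓡 n) (γ 0)).eventually near,
    extChartAt_source_mem_nhds (I := 𝓡 n) (γ 0)] with q' hq' hq's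
  have h2 := harc _ (K.center_eq ▸ hq'.1) (c s) s2 s hs1 hq'.2
  rw [hc, (extChartAt (𝓡 n) (γ 0)).left_inv s3, (extChartAt (𝓡 n) (γ 0)).left_inv hq's] at h2
  exact .tail (.single h2) (timelikeArc_of_mem_Icc hγ hv s5.1.1 s4 le_rfl)

theorem Chron.eventually_right (hk : 1 ≤ k) {p q : M} (h : S.Chron p q) :
    ∀ᶠ q' in 𝓝 q, S.Chron p q' := by
  cases h with
  | single h => exact h.eventually_chron_right hk
  | tail h h' => exact (h'.eventually_chron_right hk).mono fun _ ↦ h.trans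

theorem Chron.eventually_left (hk : 1 ≤ k) {p q : M} (h : S.Chron p q) :
    ∀ᶠ p' in 𝓝 p, S.Chron p' q := by
  induction h using Relation.TransGen.head_induction_on with
  | single h => exact h.eventually_chron_left hk
  | head h h' => exact (h.eventually_chron_left hk).mono fun _ h'' ↦ h''.trans h'

/-- There is a coordinate vector which leads from the past of `y` to `y`. -/
theorem LorentzChart.exists_eventually_timelikeArc {y : M} (K : S.LorentzChart y) :
    ∃ e, 0 < K.time e ∧ ∀ᶠ l in 𝓝[>] (0 : ℝ),
      S.TimelikeArc ((extChartAt (𝓡 n) y).symm (K.center - l • e)) y := by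
  have hs := mem_extChartAt_source (I := 𝓡 n) y
  have hball : extChartAt (𝓡 n) y y ∈ K.ball :=
    K.center_eq ▸ Metric.mem_ball_self K.radius_pos
  have ht := (K.isFutureTimelike_iff y hs hball (S.X y)).1 ⟨S.timelike_X y, S.timelike_X y⟩
  rw [← K.center_eq] at ht
  obtain ⟨ε, hε, harc⟩ := K.exists_timelikeArc_of_near ht
  refine ⟨_, ht.2, ?_⟩
  have hcont : Continuous fun l : ℝ ↦ K.center - l • coord y y (S.X y) := by fun_prop
  have h1 : ∀ᶠ l in 𝓝[>] (0 : ℝ), K.center - l • coord y y (S.X y) ∈ Metric.ball K.center ε :=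
    nhdsWithin_le_nhds (hcont.continuousAt.preimage_mem_nhds
      (by simpa using Metric.ball_mem_nhds K.center hε))
  filter_upwards [h1, self_mem_nhdsWithin] with l hl hl0
  have h2 := harc _ hl _ (Metric.mem_ball_self hε) l hl0 (by
    rw [sub_sub_cancel, smul_smul, inv_mul_cancel₀ (ne_of_gt hl0), one_smul, sub_self, norm_zero]
    exact hε)
  nth_rw 2 [K.center_eq] at h2
  rwa [extChartAt_to_inv] at h2

end TimeOrientedLorentzianMetric

/-! ### Chains of points inside a coordinate ball -/

namespace TimeOrientedLorentzianMetric.LorentzChart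

variable {n : ℕ} {k : ℕ∞} {M : Type*} [TopologicalSpace M]
  [ChartedSpace (EuclideanSpace ℝ (Fin n)) M] [IsManifold (𝓡 n) 1 M]
  {S : TimeOrientedLorentzianMetric n k M} {y : M} (K : S.LorentzChart y)

/-- The region of the manifold covered by the coordinate ball. -/
def domain : Set M := (extChartAt (𝓡 n) y).source ∩ extChartAt (𝓡 n) y ⁻¹' K.ball

/-- The coordinate time of a point. -/
noncomputable def level (m : M) : ℝ := K.time (extChartAt (𝓡 n) y m)

/-- Chronological precedence along a curve in the coordinate ball. -/
def Leads (a b : M) : Prop :=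
  S.Chron a b ∧ K.Precedes (extChartAt (𝓡 n) y a) (extChartAt (𝓡 n) y b)

theorem isOpen_domain : IsOpen K.domain :=
  (continuousOn_extChartAt y).isOpen_inter_preimage (isOpen_extChartAt_source y)
    Metric.isOpen_ball

variable {K}

theorem Leads.trans {a b c : M} (h : K.Leads a b) (h' : K.Leads b c) : K.Leads a c :=
  ⟨h.1.trans h'.1, h.2.trans h'.2⟩

theorem Leads.level_le {a b : M} (h : K.Leads a b) : K.level a ≤ K.level b :=
  ConeField.time_le_of_slope_mul_norm_le h.2.slope_mul_norm_le

section Arc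

variable {γ : ℝ → M} (hγ : ContMDiffOn 𝓘(ℝ, ℝ) (𝓡 n) 1 γ (Icc 0 1))
  (hv : ∀ t ∈ Icc (0 : ℝ) 1, S.IsFutureTimelike (velocity (n := n) γ t))
include hγ

theorem continuousOn_level_comp {s₀ : ℝ} (hs₀ : s₀ ≤ 1) (hV : ∀ s ∈ Icc 0 s₀, γ s ∈ K.domain) :
    ContinuousOn (fun s ↦ K.level (γ s)) (Icc 0 s₀) :=
  K.time.continuous.comp_continuousOn ((continuousOn_extChartAt y).comp
    (hγ.continuousOn.mono (Icc_subset_Icc_right hs₀)) fun s hs ↦ (hV s hs).1)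

include hv

theorem leads_of_arc {s₀ : ℝ} (hs₀ : s₀ ≤ 1) (hV : ∀ s ∈ Icc 0 s₀, γ s ∈ K.domain) {a b : ℝ}
    (ha : 0 ≤ a) (hab : a < b) (hb : b ≤ s₀) : K.Leads (γ a) (γ b) := by
  refine ⟨.single (timelikeArc_of_mem_Icc hγ hv ha hab (hb.trans hs₀)), .single
    ⟨fun s ↦ extChartAt (𝓡 n) y (γ s), fun s ↦ coord y (γ s) (velocity γ s), a, b, hab, rfl, rfl,
      fun s hs ↦ ?_⟩⟩
  have h0 : s ∈ Icc 0 s₀ := ⟨ha.trans hs.1, hs.2.trans hb⟩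
  have h1 : s ∈ Icc (0 : ℝ) 1 := ⟨h0.1, h0.2.trans hs₀⟩
  exact ⟨(hasDerivWithinAt_extChartAt_comp hγ h1 (hV s h0).1).mono
    (Icc_subset_Icc ha (hb.trans hs₀)), (hV s h0).2,
    (K.isFutureTimelike_iff _ (hV s h0).1 (hV s h0).2 _).1 (hv s h1)⟩

theorem lt_of_level_lt {s₀ : ℝ} (hs₀ : s₀ ≤ 1) (hV : ∀ s ∈ Icc 0 s₀, γ s ∈ K.domain) {a b : ℝ}
    (ha : a ∈ Icc 0 s₀) (hb : b ∈ Icc 0 s₀) (h : K.level (γ a) < K.level (γ b)) : a < b := by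
  by_contra! hba
  rcases hba.eq_or_lt with rfl | hba
  · exact lt_irrefl _ h
  · exact absurd (leads_of_arc hγ hv hs₀ hV hb.1 hba ha.2).level_le (not_le.2 h)

/-- While the level stays below `t₁`, the slope inequality keeps the arc in the image of a compact
coordinate ball inside the domain. That image is closed since `M` is Hausdorff, so it contains the
arc's position at a first exit time: no such exit exists. -/
theorem exists_level_eq_or_forall_mem_domain [T2Space M] {t₁ : ℝ} (hm : γ 0 ∈ K.domain)
    (ht : K.level (γ 0) ≤ t₁)
    (hball : Metric.closedBall (extChartAt (𝓡 n) y (γ 0)) ((t₁ - K.level (γ 0)) / K.slope)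
      ⊆ K.ball) :
    (∃ s, 0 ≤ s ∧ s < 1 ∧ (∀ s' ∈ Icc 0 s, γ s' ∈ K.domain) ∧ K.level (γ s) = t₁) ∨
      ∀ s ∈ Icc (0 : ℝ) 1, γ s ∈ K.domain := by
  by_contra! hcon
  obtain ⟨hlevel, s₁, hs₁, hs₁V⟩ := hcon
  have hcl : IsClosed (Icc (0 : ℝ) 1 ∩ γ ⁻¹' K.domainᶜ) :=
    hγ.continuousOn.preimage_isClosed_of_isClosed isClosed_Icc K.isOpen_domain.isClosed_compl
  obtain ⟨s, ⟨hs, hsV⟩, hmin⟩ := (isCompact_Icc.of_isClosed_subset hcl inter_subset_left).exists_isLeast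
    ⟨s₁, hs₁, hs₁V⟩
  have hV : ∀ s' ∈ Ico 0 s, γ s' ∈ K.domain := fun s' hs' ↦ by
    by_contra h
    exact absurd (hmin ⟨⟨hs'.1, hs'.2.le.trans hs.2⟩, h⟩) (not_le.2 hs'.2)
  have hs0 : 0 < s := lt_of_le_of_ne hs.1 (by rintro rfl; exact hsV hm)
  set R := Metric.closedBall (extChartAt (𝓡 n) y (γ 0)) ((t₁ - K.level (γ 0)) / K.slope) with hR
  have hRc : IsCompact ((extChartAt (𝓡 n) y).symm '' R) :=
    (isCompact_closedBall _ _).image_of_continuousOn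
      ((continuousOn_extChartAt_symm y).mono (hball.trans K.ball_subset))
  have hmaps : MapsTo γ (Ico 0 s) ((extChartAt (𝓡 n) y).symm '' R) := fun s' hs' ↦ by
    have hV' : ∀ r ∈ Icc 0 s', γ r ∈ K.domain := fun r hr ↦ hV r ⟨hr.1, hr.2.trans_lt hs'.2⟩
    have hs'1 : s' < 1 := hs'.2.trans_le hs.2
    have h1 : K.level (γ s') < t₁ := by
      by_contra! h
      obtain ⟨r, hr, hr'⟩ := intermediate_value_Icc hs'.1
        (continuousOn_level_comp hγ hs'1.le hV') ⟨ht, h⟩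
      exact hlevel r hr.1 (hr.2.trans_lt hs'1) (fun q hq ↦ hV' q ⟨hq.1, hq.2.trans hr.2⟩) hr'
    refine ⟨_, ?_, (extChartAt (𝓡 n) y).left_inv (hV s' hs').1⟩
    rcases hs'.1.eq_or_lt with rfl | h0
    · exact Metric.mem_closedBall_self (div_nonneg (sub_nonneg.2 ht) K.slope_pos.le)
    · have h2 := (leads_of_arc hγ hv hs'1.le hV' le_rfl h0 le_rfl).2.slope_mul_norm_le
      rw [map_sub] at h2
      rw [hR, mem_closedBall_iff_norm, le_div_iff₀ K.slope_pos, mul_comm]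
      exact h2.trans (sub_le_sub_right h1.le _)
  have h1 : γ s ∈ closure ((extChartAt (𝓡 n) y).symm '' R) :=
    ((hγ.continuousOn s hs).mono fun r hr ↦ ⟨hr.1, hr.2.le.trans hs.2⟩).mem_closure
      (by rw [closure_Ico hs0.ne]; exact right_mem_Icc.2 hs0.le) hmaps
  rw [hRc.isClosed.closure_eq] at h1
  obtain ⟨u, hu, hus⟩ := h1
  refine hsV ⟨?_, ?_⟩
  · rw [← hus]
    exact (extChartAt (𝓡 n) y).map_target (K.ball_subset (hball hu))
  · rw [mem_preimage, ← hus, (extChartAt (𝓡 n) y).right_inv (K.ball_subset (hball hu))]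
    exact hball hu

end Arc

variable (K) in
/-- There is a chain of points from `m` in the past of `x`, in the coordinate ball, which meets
every level up to `t₁`. -/
def HasChain (x m : M) (t₁ : ℝ) : Prop :=
  ∃ A : Set M, (∀ a ∈ A, a ∈ K.domain ∧ (a = m ∨ K.Leads m a) ∧ S.Chron a x) ∧
    (∀ a ∈ A, ∀ b ∈ A, K.level a < K.level b → K.Leads a b) ∧
    ∀ t ∈ Icc (K.level m) t₁, ∃ a ∈ A, K.level a = t

theorem hasChain_of_arc {γ : ℝ → M} (hγ : ContMDiffOn 𝓘(ℝ, ℝ) (𝓡 n) 1 γ (Icc 0 1))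
    (hv : ∀ t ∈ Icc (0 : ℝ) 1, S.IsFutureTimelike (velocity (n := n) γ t)) {s₀ : ℝ} (h0 : 0 ≤ s₀)
    (hs₀ : s₀ ≤ 1) (hV : ∀ s ∈ Icc 0 s₀, γ s ∈ K.domain) {x : M}
    (hx : ∀ s ∈ Icc 0 s₀, S.Chron (γ s) x) : K.HasChain x (γ 0) (K.level (γ s₀)) := by
  refine ⟨γ '' Icc 0 s₀, ?_, ?_, fun t ht ↦ ?_⟩
  · rintro _ ⟨s, hs, rfl⟩
    refine ⟨hV s hs, ?_, hx s hs⟩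
    rcases hs.1.eq_or_lt with rfl | h
    · exact .inl rfl
    · exact .inr (leads_of_arc hγ hv hs₀ hV le_rfl h hs.2)
  · rintro _ ⟨a, ha, rfl⟩ _ ⟨b, hb, rfl⟩ hab
    exact leads_of_arc hγ hv hs₀ hV ha.1 (lt_of_level_lt hγ hv hs₀ hV ha hb hab) hb.2
  · obtain ⟨s, hs, hst⟩ := intermediate_value_Icc h0 (continuousOn_level_comp hγ hs₀ hV) ht
    exact ⟨_, mem_image_of_mem _ hs, hst⟩

theorem HasChain.mono {x m : M} {t₁ t₂ : ℝ} (h : K.HasChain x m t₂) (ht : t₁ ≤ t₂) :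
    K.HasChain x m t₁ := by
  obtain ⟨A, h1, h2, h3⟩ := h
  exact ⟨A, h1, h2, fun t h ↦ h3 t ⟨h.1, h.2.trans ht⟩⟩

/-- Since `x` lies outside the domain, a timelike curve from `m` to `x` cannot stay inside, and it
must meet every level up to `t₁` before leaving. The induction peels off initial arcs; recording a
set of points instead of a curve avoids gluing parametrizations. -/
theorem hasChain_of_chron [T2Space M] {x m : M} (h : S.Chron m x) (hx : x ∉ K.domain) {t₁ : ℝ}
    (hm : m ∈ K.domain)
    (hball : Metric.closedBall (extChartAt (𝓡 n) y m) ((t₁ - K.level m) / K.slope) ⊆ K.ball) :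
    K.HasChain x m t₁ := by
  rcases lt_or_ge t₁ (K.level m) with hlt | ht
  · exact ⟨∅, by simp, by simp, fun t h ↦ absurd (h.1.trans h.2) (not_le.2 hlt)⟩
  induction h using Relation.TransGen.head_induction_on with
  | @single m h =>
    obtain ⟨γ, hγ, rfl, rfl, hv⟩ := h
    rcases exists_level_eq_or_forall_mem_domain hγ hv hm ht hball with
      ⟨s, hs0, hs1, hV, rfl⟩ | hV
    · exact hasChain_of_arc hγ hv hs0 hs1.le hV fun r hr ↦
        .single (timelikeArc_of_mem_Icc hγ hv hr.1 (hr.2.trans_lt hs1) le_rfl)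
    · exact absurd (hV 1 (right_mem_Icc.2 zero_le_one)) hx
  | @head m m' h h' ih =>
    obtain ⟨γ, hγ, rfl, rfl, hv⟩ := h
    have hxs : ∀ r ∈ Icc (0 : ℝ) 1, S.Chron (γ r) x := fun r hr ↦ by
      rcases hr.2.eq_or_lt with rfl | h1
      · exact h'
      · exact .head (timelikeArc_of_mem_Icc hγ hv hr.1 h1 le_rfl) h'
    rcases exists_level_eq_or_forall_mem_domain hγ hv hm ht hball with
      ⟨s, hs0, hs1, hV, rfl⟩ | hV
    · exact hasChain_of_arc hγ hv hs0 hs1.le hV fun r hr ↦ hxs r ⟨hr.1, hr.2.trans hs1.le⟩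
    have hc := hasChain_of_arc hγ hv zero_le_one le_rfl hV hxs
    rcases le_or_gt t₁ (K.level (γ 1)) with h1 | h1
    · exact hc.mono h1
    have hl : K.Leads (γ 0) (γ 1) := leads_of_arc hγ hv le_rfl hV le_rfl zero_lt_one le_rfl
    have hl' := hl.2.slope_mul_norm_le
    have hc' := ih (hV 1 (right_mem_Icc.2 zero_le_one)) (by
      -- Moving the centre to `γ 1` costs at most the gain in level divided by the slope, which is
      -- exactly how much the radius shrinks.
      refine (Metric.closedBall_subset_closedBall' ?_).trans hball
      rw [dist_eq_norm, ← le_sub_iff_add_le', ← sub_div, le_div_iff₀ K.slope_pos, mul_comm]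
      rw [map_sub] at hl'
      simp only [level]
      linarith) h1.le
    have hs1 : ∀ s ∈ Icc (0 : ℝ) 1, γ s = γ 1 ∨ K.Leads (γ s) (γ 1) := fun s hs ↦ by
      rcases hs.2.eq_or_lt with rfl | h
      · exact .inl rfl
      · exact .inr (leads_of_arc hγ hv le_rfl hV hs.1 h le_rfl)
    obtain ⟨A, hA1, hA2, hA3⟩ := hc'
    refine ⟨γ '' Icc 0 1 ∪ A, ?_, ?_, fun t ht ↦ ?_⟩
    · rintro a (⟨s, hs, rfl⟩ | ha)
      · refine ⟨hV s hs, ?_, hxs s hs⟩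
        rcases hs.1.eq_or_lt with rfl | h
        · exact .inl rfl
        · exact .inr (leads_of_arc hγ hv le_rfl hV le_rfl h hs.2)
      · obtain ⟨h2, h3, h4⟩ := hA1 a ha
        refine ⟨h2, .inr ?_, h4⟩
        rcases h3 with rfl | h3
        exacts [hl, hl.trans h3]
    · rintro a (⟨s, hs, rfl⟩ | ha) b (⟨r, hr, rfl⟩ | hb) hab
      · exact leads_of_arc hγ hv le_rfl hV hs.1 (lt_of_level_lt hγ hv le_rfl hV hs hr hab) hr.2
      · rcases (hA1 b hb).2.1 with rfl | h2
        · rcases hs1 s hs with h3 | h3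
          · exact absurd hab (by rw [h3]; exact lt_irrefl _)
          · exact h3
        · rcases hs1 s hs with h3 | h3
          · rwa [h3]
          · exact h3.trans h2
      · exfalso
        have h2 : K.level (γ 1) ≤ K.level a := by
          rcases (hA1 a ha).2.1 with rfl | h2
          exacts [le_rfl, h2.level_le]
        have h3 : K.level (γ r) ≤ K.level (γ 1) := by
          rcases hs1 r hr with h3 | h3
          exacts [h3 ▸ le_rfl, h3.level_le]
        linarith
      · exact hA2 a ha b hb hab
    · rcases le_or_gt t (K.level (γ 1)) with h2 | h2
      · obtain ⟨s, hs, hst⟩ := intermediate_value_Icc zero_le_one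
          (continuousOn_level_comp hγ le_rfl hV) ⟨ht.1, h2⟩
        exact ⟨_, .inl (mem_image_of_mem _ hs), hst⟩
      · obtain ⟨a, ha, hat⟩ := hA3 t ⟨h2.le, ht.2⟩
        exact ⟨a, .inr ha, hat⟩

end TimeOrientedLorentzianMetric.LorentzChart

/-! ### The limit curve and the proof of distinction -/

namespace TimeOrientedLorentzianMetric

variable {n : ℕ} {k : ℕ∞} {M : Type*} [TopologicalSpace M]
  [ChartedSpace (EuclideanSpace ℝ (Fin n)) M] [IsManifold (𝓡 n) 1 M]
  {S : TimeOrientedLorentzianMetric n k M}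

theorem exists_lorentzChart_notMem_domain (S : TimeOrientedLorentzianMetric n k M) (hk : 1 ≤ k)
    {x y : M} (hxy : x ≠ y) : ∃ K : S.LorentzChart y, x ∉ K.domain := by
  by_cases hx : x ∈ (extChartAt (𝓡 n) y).source
  · have hne : extChartAt (𝓡 n) y x ≠ extChartAt (𝓡 n) y y := fun h ↦
      hxy ((extChartAt (𝓡 n) y).injOn hx (mem_extChartAt_source y) h)
    obtain ⟨K, hK⟩ := S.exists_lorentzChart hk y (dist_pos.2 hne)
    refine ⟨K, fun h ↦ ?_⟩
    have h1 : dist (extChartAt (𝓡 n) y x) K.center < K.radius := h.2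
    rw [K.center_eq] at h1
    linarith
  · obtain ⟨K, -⟩ := S.exists_lorentzChart hk y one_pos
    exact ⟨K, fun h ↦ hx h.1⟩

theorem LorentzChart.tendsto_symm {y : M} (K : S.LorentzChart y) {ι : Type*} {l : Filter ι}
    {f : ι → EuclideanSpace ℝ (Fin n)} {u : EuclideanSpace ℝ (Fin n)} (hu : u ∈ K.ball)
    (hf : Filter.Tendsto f l (𝓝 u)) :
    Filter.Tendsto (fun i ↦ (extChartAt (𝓡 n) y).symm (f i)) l
      (𝓝 ((extChartAt (𝓡 n) y).symm u)) :=
  (continuousAt_extChartAt_symm'' (K.ball_subset hu)).tendsto.comp hf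

theorem LorentzChart.center_mem_ball {y : M} (K : S.LorentzChart y) : K.center ∈ K.ball :=
  Metric.mem_ball_self K.radius_pos

theorem LorentzChart.symm_center {y : M} (K : S.LorentzChart y) :
    (extChartAt (𝓡 n) y).symm K.center = y := by
  rw [K.center_eq, extChartAt_to_inv]

/-- If a curve in the past of `x` starts near `y` and leaves the coordinate ball around `y`, then
in the limit there is a Lipschitz curve starting at `y` which is causal up to third order. -/
theorem LorentzChart.exists_limit_curve [T2Space M] {x y : M} (K : S.LorentzChart y) (hk : 1 ≤ k)
    (hx : x ∉ K.domain) (hxy : S.chronPast y ⊆ S.chronPast x) :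
    ∃ (δ : ℝ) (σ : ℝ → EuclideanSpace ℝ (Fin n)), 0 < δ ∧ σ 0 = K.center ∧
      (∀ t ∈ Icc 0 δ, σ t ∈ K.ball ∧ K.time (σ t) = K.time K.center + t ∧
        S.chronPast ((extChartAt (𝓡 n) y).symm (σ t)) ⊆ S.chronPast x ∧
        ∀ p ∈ S.chronPast y, S.chronFuture ((extChartAt (𝓡 n) y).symm (σ t)) ⊆ S.chronFuture p) ∧
      ∀ s ∈ Icc 0 δ, ∀ t ∈ Icc 0 δ, s < t → K.slope * ‖σ t - σ s‖ ≤ t - s ∧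
        K.metric (σ s) (σ t - σ s) (σ t - σ s) ≤ K.L / K.slope ^ 3 * (t - s) ^ 3 := by
  set φ := extChartAt (𝓡 n) y with hφ
  have hκ := K.slope_pos
  have hr := K.radius_pos
  obtain ⟨e, he, hpast⟩ := K.exists_eventually_timelikeArc
  set R := K.radius / 2 with hR
  have hR0 : 0 < R := by positivity
  have hRball : Metric.closedBall K.center R ⊆ K.ball :=
    Metric.closedBall_subset_ball (by rw [hR]; linarith)
  -- With `l * K.time e` also below `K.slope * R / 4`, a chain up to time `δ` stays within `R / 2`
  -- of its start `ζ l`, which is itself within `R / 2` of the centre.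
  set δ := K.slope * R / 4 with hδ
  have hδ0 : 0 < δ := by positivity
  set ζ : ℝ → EuclideanSpace ℝ (Fin n) := fun l ↦ K.center - l • e with hζ
  have hζc : Filter.Tendsto ζ (𝓝[>] 0) (𝓝 K.center) := by
    have : Continuous ζ := by fun_prop
    simpa [hζ] using (this.tendsto 0).mono_left nhdsWithin_le_nhds
  have hsmall : ∀ᶠ l in 𝓝[>] (0 : ℝ), ζ l ∈ Metric.closedBall K.center (R / 2) :=
    hζc (Metric.closedBall_mem_nhds _ (by positivity))
  have hsmall' : ∀ᶠ l in 𝓝[>] (0 : ℝ), l * K.time e < K.slope * R / 4 := by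
    have : Continuous fun l : ℝ ↦ l * K.time e := by fun_prop
    refine ((this.tendsto 0).mono_left nhdsWithin_le_nhds).eventually_lt_const ?_
    rw [zero_mul]; positivity
  have hchain : ∀ᶠ l in 𝓝[>] (0 : ℝ), ∃ w : ℝ → M, ∀ t ∈ Icc 0 δ,
      (w t ∈ K.domain ∧ φ (w t) ∈ Metric.closedBall K.center R ∧
        K.level (w t) = K.time K.center + t ∧ S.Chron (w t) x ∧
        (w t = φ.symm (ζ l) ∨ S.Chron (φ.symm (ζ l)) (w t)) ∧
        K.slope * ‖φ (w t) - ζ l‖ ≤ t + l * K.time e) ∧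
        ∀ s ∈ Icc 0 δ, s < t → K.Precedes (φ (w s)) (φ (w t)) := by
    filter_upwards [hpast, hsmall, hsmall', self_mem_nhdsWithin] with l h1 h2 h3 h4
    have h4' : 0 < l := h4
    have hζR : ζ l ∈ K.ball := hRball (Metric.closedBall_subset_closedBall (by linarith) h2)
    have hri : φ (φ.symm (ζ l)) = ζ l := φ.right_inv (K.ball_subset hζR)
    have hlev : K.level (φ.symm (ζ l)) = K.time K.center - l * K.time e := by
      rw [level, hri, hζ]; simp
    have hsub : Metric.closedBall (ζ l)
        ((K.time K.center + δ - K.level (φ.symm (ζ l))) / K.slope) ⊆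
        Metric.closedBall K.center R := by
      refine Metric.closedBall_subset_closedBall' ?_
      have h5 : (K.time K.center + δ - K.level (φ.symm (ζ l))) / K.slope ≤ R / 2 := by
        rw [div_le_iff₀ hκ, hlev, hδ]; linarith
      linarith [Metric.mem_closedBall.1 h2]
    obtain ⟨A, hA1, hA2, hA3⟩ := hasChain_of_chron (K := K) (t₁ := K.time K.center + δ)
      (hxy (show S.Chron (φ.symm (ζ l)) y from .single h1)) hx
      ⟨φ.map_target (K.ball_subset hζR), by rw [mem_preimage, ← hφ, hri]; exact hζR⟩
      (by rw [← hφ, hri]; exact hsub.trans hRball)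
    have hex : ∀ t ∈ Icc 0 δ, ∃ a ∈ A, K.level a = K.time K.center + t := fun t ht ↦
      hA3 _ ⟨by rw [hlev]; linarith [ht.1, mul_pos h4' he], by linarith [ht.2]⟩
    have : Nonempty M := ⟨y⟩
    choose! w hw hwl using hex
    have hnear : ∀ t ∈ Icc 0 δ, K.slope * ‖φ (w t) - ζ l‖ ≤ t + l * K.time e := fun t ht ↦ by
      have h6 : K.time (φ (w t)) = K.time K.center + t := hwl t ht
      have h7 : K.time (ζ l) = K.time K.center - l * K.time e := by rw [hζ]; simp
      rcases (hA1 _ (hw t ht)).2.1 with h | h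
      · rw [h, hri, sub_self, norm_zero, mul_zero]
        linarith [ht.1, mul_pos h4' he]
      · have h5 := h.2.slope_mul_norm_le
        rw [← hφ, hri, map_sub, h6, h7] at h5
        linarith
    refine ⟨w, fun t ht ↦ ⟨⟨(hA1 _ (hw t ht)).1, hsub ?_, hwl t ht, (hA1 _ (hw t ht)).2.2,
      (hA1 _ (hw t ht)).2.1.imp id And.left, hnear t ht⟩, fun s hs hst ↦
      (hA2 _ (hw s hs) _ (hw t ht) (by rw [hwl s hs, hwl t ht]; linarith)).2⟩⟩
    rw [mem_closedBall_iff_norm, le_div_iff₀ hκ, mul_comm, hlev]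
    linarith [hnear t ht, ht.2]
  obtain ⟨w, hw⟩ := hchain.choice
  -- Along an ultrafilter the points `w l t` converge for all `t` simultaneously, by compactness of
  -- the closed ball alone; no equicontinuity or diagonal extraction is needed.
  set 𝒰 := Ultrafilter.of (𝓝[>] (0 : ℝ)) with h𝒰
  have h𝒰le : (𝒰 : Filter ℝ) ≤ 𝓝[>] 0 := Ultrafilter.of_le _
  replace hw := hw.filter_mono h𝒰le
  have hlim : ∀ t ∈ Icc 0 δ, ∃ u ∈ Metric.closedBall K.center R,
      Filter.Tendsto (fun l ↦ φ (w l t)) 𝒰 (𝓝 u) := fun t ht ↦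
    (isCompact_closedBall K.center R).ultrafilter_le_nhds (𝒰.map fun l ↦ φ (w l t))
      (Filter.le_principal_iff.2 (hw.mono fun l hl ↦ (hl t ht).1.2.1))
  choose! σ hσR hσ using hlim
  have hζ𝒰 : Filter.Tendsto ζ 𝒰 (𝓝 K.center) := hζc.mono_left h𝒰le
  have hzy : Filter.Tendsto (fun l ↦ φ.symm (ζ l)) 𝒰 (𝓝 y) := by
    have := K.tendsto_symm K.center_mem_ball hζ𝒰
    rwa [K.symm_center] at this
  have hwt : ∀ t ∈ Icc 0 δ, Filter.Tendsto (fun l ↦ w l t) 𝒰 (𝓝 (φ.symm (σ t))) := fun t ht ↦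
    (K.tendsto_symm (hRball (hσR t ht)) (hσ t ht)).congr'
      (hw.mono fun l hl ↦ φ.left_inv (hl t ht).1.1.1)
  have h0 : (0 : ℝ) ∈ Icc 0 δ := left_mem_Icc.2 hδ0.le
  have htime : ∀ t ∈ Icc 0 δ, K.time (σ t) = K.time K.center + t := fun t ht ↦ by
    refine tendsto_nhds_unique ((K.time.continuous.tendsto _).comp (hσ t ht))
      (tendsto_const_nhds.congr' ?_)
    exact hw.mono fun l hl ↦ (hl t ht).1.2.2.1.symm
  refine ⟨δ, σ, hδ0, ?_, fun t ht ↦ ⟨hRball (hσR t ht), htime t ht, ?_, ?_⟩, ?_⟩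
  · have h1 : Filter.Tendsto (fun l ↦ K.slope * ‖φ (w l 0) - ζ l‖) 𝒰
        (𝓝 (K.slope * ‖σ 0 - K.center‖)) := ((hσ 0 h0).sub hζ𝒰).norm.const_mul _
    have h2 : Filter.Tendsto (fun l : ℝ ↦ 0 + l * K.time e) 𝒰 (𝓝 0) := by
      have : Continuous fun l : ℝ ↦ 0 + l * K.time e := by fun_prop
      simpa using (this.tendsto 0).mono_left (h𝒰le.trans nhdsWithin_le_nhds)
    have h3 := le_of_tendsto_of_tendsto h1 h2 (hw.mono fun l hl ↦ (hl 0 h0).1.2.2.2.2.2)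
    have h4 : ‖σ 0 - K.center‖ ≤ 0 := by
      by_contra! h
      linarith [mul_pos hκ h]
    exact sub_eq_zero.1 (norm_le_zero_iff.1 h4)
  · intro p hp
    have h1 := (hwt t ht).eventually (Chron.eventually_right hk hp)
    obtain ⟨l, hl, hl'⟩ := (h1.and hw).exists
    exact Relation.TransGen.trans hl (hl' t ht).1.2.2.2.1
  · intro p hp q hq
    have h1 := (hwt t ht).eventually (Chron.eventually_left hk hq)
    have h2 := hzy.eventually (Chron.eventually_right hk hp)
    obtain ⟨l, hl1, hl2, hl3⟩ := (h1.and (h2.and hw)).exists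
    rcases (hl3 t ht).1.2.2.2.2.1 with h | h
    · rw [h] at hl1
      exact Relation.TransGen.trans hl2 hl1
    · exact Relation.TransGen.trans hl2 (Relation.TransGen.trans h hl1)
  · intro s hs t ht hst
    have hd := (hσ t ht).sub (hσ s hs)
    have hdt : ∀ᶠ l in (𝒰 : Filter ℝ), K.time (φ (w l t) - φ (w l s)) = t - s :=
      hw.mono fun l hl ↦ by
        have h1 : K.time (φ (w l t)) = _ := (hl t ht).1.2.2.1
        have h2 : K.time (φ (w l s)) = _ := (hl s hs).1.2.2.1
        rw [map_sub, h1, h2]; ring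
    constructor
    · refine le_of_tendsto (hd.norm.const_mul _) ?_
      filter_upwards [hw, hdt] with l hl hl'
      rw [← hl']
      exact ((hl t ht).2 s hs hst).slope_mul_norm_le
    · have hg : Filter.Tendsto (fun l ↦ K.metric (φ (w l s))) 𝒰 (𝓝 (K.metric (σ s))) :=
        (K.continuousAt_metric (hRball (hσR s hs))).tendsto.comp (hσ s hs)
      have h1 : Filter.Tendsto (fun l ↦ K.metric (φ (w l s)) (φ (w l t) - φ (w l s))
          (φ (w l t) - φ (w l s))) 𝒰 (𝓝 (K.metric (σ s) (σ t - σ s) (σ t - σ s))) :=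
        ((show Continuous fun p : (EuclideanSpace ℝ (Fin n) →L[ℝ] EuclideanSpace ℝ (Fin n) →L[ℝ] ℝ)
          × EuclideanSpace ℝ (Fin n) ↦ p.1 p.2 p.2 by fun_prop).tendsto _).comp
          (hg.prodMk_nhds hd)
      refine le_of_tendsto h1 ?_
      filter_upwards [hw, hdt] with l hl hl'
      rw [← hl']
      exact ((hl t ht).2 s hs hst).metric_le

/-- A feebly distinguishing spacetime has no closed timelike curves. -/
theorem FeeblyDistinguishing.not_chron_self (hk : 1 ≤ k) (hS : S.FeeblyDistinguishing) (p : M) :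
    ¬ S.Chron p p := by
  intro hp
  obtain ⟨K, -⟩ := S.exists_lorentzChart hk p one_pos
  obtain ⟨e, he, hpast⟩ := K.exists_eventually_timelikeArc
  have hc : Filter.Tendsto (fun l : ℝ ↦ K.center - l • e) (𝓝[>] 0) (𝓝 K.center) := by
    have : Continuous fun l : ℝ ↦ K.center - l • e := by fun_prop
    simpa using (this.tendsto 0).mono_left nhdsWithin_le_nhds
  have hz := K.tendsto_symm K.center_mem_ball hc
  rw [K.symm_center] at hz
  -- A point z slightly before `p` also satisfies p ≪ z by openness. Then z and `p` have equal
  -- futures and pasts and are causally related, yet differ in coordinate time.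
  obtain ⟨l, h1, h2, h3, h4⟩ := (hpast.and ((hz.eventually (hp.eventually_right hk)).and
    ((hc.eventually (Metric.isOpen_ball.mem_nhds K.center_mem_ball)).and
      self_mem_nhdsWithin))).exists
  have h1' : S.Chron _ p := .single h1
  have heq := hS _ p h1'.causal
    (Subset.antisymm (fun q hq ↦ h2.trans hq) fun q hq ↦ h1'.trans hq)
    (Subset.antisymm (fun q hq ↦ Relation.TransGen.trans hq h1')
      fun q hq ↦ Relation.TransGen.trans hq h2)
  have h5 := congrArg (extChartAt (𝓡 n) p) heq
  rw [(extChartAt (𝓡 n) p).right_inv (K.ball_subset h3), ← K.center_eq] at h5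
  have h6 := congrArg K.time h5
  rw [map_sub, map_smul, smul_eq_mul] at h6
  have : 0 < l * K.time e := mul_pos h4 he
  linarith

/-- Every point of the limit curve from `y` has the past and future of `y`. Achronality makes the
curve null to third order, hence C¹ and causal, and its endpoint contradicts feeble distinction. -/
theorem FeeblyDistinguishing.pastDistinguishing [T2Space M] (hk : 1 ≤ k)
    (hS : S.FeeblyDistinguishing) (hR : S.Reflecting) : S.PastDistinguishing := by
  intro x y hxy
  by_contra hne
  obtain ⟨K, hK⟩ := S.exists_lorentzChart_notMem_domain hk hne
  obtain ⟨δ, σ, hδ, hσ0, hσ, hσ'⟩ := K.exists_limit_curve hk hK hxy.ge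
  have hκ := K.slope_pos
  set m : ℝ → M := fun t ↦ (extChartAt (𝓡 n) y).symm (σ t) with hm
  have hpast : ∀ t ∈ Icc 0 δ, S.chronPast (m t) = S.chronPast y := by
    intro t ht
    obtain ⟨-, -, h1, h2⟩ := hσ t ht
    refine Subset.antisymm (h1.trans hxy.le) fun p hp ↦ ?_
    obtain ⟨e, -, he⟩ := K.exists_eventually_timelikeArc
    have hc : Filter.Tendsto (fun l : ℝ ↦ K.center - l • e) (𝓝[>] 0) (𝓝 K.center) := by
      have : Continuous fun l : ℝ ↦ K.center - l • e := by fun_prop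
      simpa using (this.tendsto 0).mono_left nhdsWithin_le_nhds
    have hz := K.tendsto_symm K.center_mem_ball hc
    rw [K.symm_center] at hz
    obtain ⟨l, h3, h4⟩ := (he.and (hz.eventually (Chron.eventually_right hk hp))).exists
    -- Openness inserts z with p ≪ z ≪ y. The limit curve gives I⁺(σ(t)) ⊆ I⁺(z), and past
    -- reflectivity turns this into I⁻(z) ⊆ I⁻(σ(t)).
    exact hR.2 _ _ (h2 _ (.single h3)) h4
  have hfuture : ∀ t ∈ Icc 0 δ, S.chronFuture (m t) = S.chronFuture y := fun t ht ↦
    Subset.antisymm (hR.1 _ _ (hpast t ht).ge) (hR.1 _ _ (hpast t ht).le)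
  have hach : ∀ s ∈ Icc 0 δ, ∀ t ∈ Icc 0 δ, ¬ S.Chron (m s) (m t) := fun s hs t ht h ↦ by
    have h1 : m s ∈ S.chronPast (m t) := h
    rw [hpast t ht, ← hpast s hs] at h1
    exact hS.not_chron_self hk _ h1
  have hL : ∀ s ∈ Icc 0 δ, ∀ t ∈ Icc 0 δ, s < t →
      ∀ u ∈ K.ball, ∀ w ∈ K.ball, ‖u - w‖ ≤ ‖σ t - σ s‖ →
      |K.metric u (σ t - σ s) (σ t - σ s) - K.metric w (σ t - σ s) (σ t - σ s)|
        ≤ K.L / K.slope ^ 3 * (t - s) ^ 3 := by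
    intro s hs t ht hst u hu w hw huw
    refine (ConeField.abs_metric_sub_le hu hw _).trans ?_
    have h1 := (hσ' s hs t ht hst).1
    have hL0 := K.L_nonneg
    calc K.L * ‖u - w‖ * ‖σ t - σ s‖ ^ 2 ≤ K.L * ‖σ t - σ s‖ * ‖σ t - σ s‖ ^ 2 := by gcongr
      _ = K.L / K.slope ^ 3 * (K.slope * ‖σ t - σ s‖) ^ 3 := by field_simp
      _ ≤ _ := by gcongr
  have hnull : ∀ s ∈ Icc 0 δ, ∀ t ∈ Icc 0 δ, s < t →
      |K.metric (σ s) (σ t - σ s) (σ t - σ s)| ≤ K.L / K.slope ^ 3 * (t - s) ^ 3 := by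
    intro s hs t ht hst
    refine abs_le.2 ⟨?_, (hσ' s hs t ht hst).2⟩
    by_contra! hlt
    -- A chord whose square lies below the third-order error stays timelike for the metric at every
    -- point of the straight segment, which would then chronologically relate two points of the
    -- curve.
    refine hach s hs t ht (.single (K.timelikeArc_of_segment (hσ s hs).1 (hσ t ht).1
      fun u hu ↦ ⟨?_, ?_⟩))
    · have hub := (convex_ball K.center K.radius).segment_subset (hσ s hs).1 (hσ t ht).1 hu
      have h1 := hL s hs t ht hst u hub (σ s) (hσ s hs).1 (by
        obtain ⟨θ, hθ, rfl⟩ := (segment_eq_image_lineMap ℝ (σ s) (σ t)) ▸ hu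
        rw [AffineMap.lineMap_apply_module', add_sub_cancel_right, norm_smul,
          Real.norm_of_nonneg hθ.1]
        exact mul_le_of_le_one_left (norm_nonneg _) hθ.2)
      linarith [(abs_le.1 h1).2]
    · rw [map_sub, (hσ s hs).2.1, (hσ t ht).2.1]
      linarith
  have hL0 : 0 ≤ K.L / K.slope ^ 3 := div_nonneg K.L_nonneg (by positivity)
  -- The constant is doubled because for `t < s` the metric must be evaluated at the later endpoint,
  -- which adds one more Lipschitz error.
  obtain ⟨σ', hcont, hder⟩ := ConeField.exists_hasDerivWithinAt_of_abs_metric_le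
    (K := K.toConeField) (σ := σ) (τ := K.time K.center) (A := 2 * (K.L / K.slope ^ 3)) hδ
    (fun t ht ↦ (hσ t ht).1) (fun t ht ↦ (hσ t ht).2.1)
    (fun s hs t ht ↦ by
      rcases lt_trichotomy s t with h | rfl | h
      · rw [abs_of_pos (sub_pos.2 h)]; exact (hσ' s hs t ht h).1
      · simp
      · rw [norm_sub_rev, abs_sub_comm, abs_of_pos (sub_pos.2 h)]; exact (hσ' t ht s hs h).1)
    (fun s hs t ht ↦ by
      rcases lt_trichotomy s t with h | rfl | h
      · have h1 := hnull s hs t ht h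
        have h2 : 0 ≤ K.L / K.slope ^ 3 * (t - s) ^ 3 :=
          mul_nonneg hL0 (pow_nonneg (sub_pos.2 h).le _)
        rw [abs_of_pos (sub_pos.2 h)]
        linarith
      · simp
      · have h1 := abs_le.1 (hnull t ht s hs h)
        have h2 := abs_le.1 (hL t ht s hs h (σ s) (hσ s hs).1 (σ t) (hσ t ht).1 le_rfl)
        rw [abs_sub_comm t s, abs_of_pos (sub_pos.2 h), ← neg_sub (σ s) (σ t)]
        simp only [map_neg, neg_apply, neg_neg]
        exact abs_le.2 ⟨by linarith [h1.1, h2.1], by linarith [h1.2, h2.2]⟩)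
  have hδm : δ ∈ Icc 0 δ := right_mem_Icc.2 hδ.le
  have hmaps : MapsTo (fun s : ℝ ↦ δ * s) (Icc 0 1) (Icc 0 δ) := fun s hs ↦
    ⟨mul_nonneg hδ.le hs.1, mul_le_of_le_one_right hδ.le hs.2⟩
  have harc : S.CausalArc y (m δ) := by
    have h1 := K.causalArc (c := fun s ↦ σ (δ * s)) (c' := fun s ↦ δ • σ' (δ * s))
      ((hcont.comp (by fun_prop) hmaps).const_smul δ)
      (fun s hs ↦ ⟨HasDerivWithinAt.scomp s (hder _ (hmaps hs)).1
          (by simpa using ((hasDerivAt_id s).const_mul δ).hasDerivWithinAt) hmaps,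
        (hσ _ (hmaps hs)).1⟩)
      (fun s hs ↦ by
        obtain ⟨-, h2, h3⟩ := hder _ (hmaps hs)
        constructor
        · simp [h2]
        · simpa [h3] using hδ)
    simp only [mul_zero, mul_one, hσ0, K.symm_center] at h1
    exact h1
  have heq := hS y (m δ) (.single harc) (hfuture δ hδm).symm (hpast δ hδm).symm
  have h5 := congrArg (extChartAt (𝓡 n) y) heq
  rw [(extChartAt (𝓡 n) y).right_inv (K.ball_subset (hσ δ hδm).1), ← K.center_eq] at h5
  have h6 := congrArg K.time h5
  rw [(hσ δ hδm).2.1] at h6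
  linarith

/-- Past reflectivity, applied both ways, turns equal futures into equal pasts, so future
distinction reduces to past distinction. -/
theorem FeeblyDistinguishing.distinguishing [T2Space M] (hk : 1 ≤ k)
    (hS : S.FeeblyDistinguishing) (hR : S.Reflecting) : S.Distinguishing :=
  ⟨fun x y h ↦ hS.pastDistinguishing hk hR x y
    (Subset.antisymm (hR.2 x y h.ge) (hR.2 y x h.le)), hS.pastDistinguishing hk hR⟩

end TimeOrientedLorentzianMetric

/-- Let `(M, g)` be a `C^r` spacetime, `r ∈ {3, …, ∞}`, of dimension `n ≥ 2`: a connected Hausdorff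
`C^r` manifold with a time-oriented Lorentzian metric of class `C^(r-1)`. It is causally continuous
if and only if it is feebly distinguishing and reflecting. (The instance `IsManifold (𝓡 n) 1 M`
follows from `IsManifold (𝓡 n) r M`; it is needed for the tangent bundle to be found.) -/
theorem mainTheorem1 (n : ℕ) (hn : 2 ≤ n) (r : ℕ∞) (hr : 3 ≤ r)
    (M : Type*) [TopologicalSpace M] [T2Space M] [ConnectedSpace M]
    [ChartedSpace (EuclideanSpace ℝ (Fin n)) M] [IsManifold (𝓡 n) r M] [IsManifold (𝓡 n) 1 M]
    (S : TimeOrientedLorentzianMetric n (r - 1) M) :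
    S.CausallyContinuous ↔ S.FeeblyDistinguishing ∧ S.Reflecting := by
  have hk : 1 ≤ r - 1 := by
    have : (3 : ℕ∞) - 1 ≤ r - 1 := tsub_le_tsub_right hr 1
    exact le_trans (by decide) this
  exact ⟨fun h ↦ ⟨fun x y _ hxy _ ↦ h.1.1 x y hxy, h.2⟩,
    fun h ↦ ⟨h.1.distinguishing hk h.2, h.2⟩⟩
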